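/- A \emph{homogeneous group} is a connected, simply connected (real, finite-dimensional) Lie group $G$ whose Lie algebra $\mathfrak g$ is endowed with a dilation matrix $\Lambda$, that is, a derivation $\Lambda\colon\mathfrak g\to\mathfrak g$ that is diagonalisable with positive eigenvalues; its dilations $\delta_t$ ($t>0$) are the smooth automorphisms of $G$ whose differential at the identity is $t^{\Lambda}=\exp(\Lambda\log t)$, and its homogeneous dimension is $Q=\operatorname{trace}(\Lambda)$. For spaces $X, X_1,\dots,X_J$ with measures, maps $\sigma_j\colon X\to X_j$ and exponents $p_j\in[1,\infty]$, let $\mathbf{BL}(X,\boldsymbol\sigma,\boldsymbol p)\in[0,\infty]$ be the smallest $C$ such that, for all $f_j\in C_c(X_j)$, the function $\prod_j f_j\circ\sigma_j$ is integrable on $X$ and $$\Bigl|\int_X\prod_j f_j(\sigma_j(x))\,dx\Bigr|\le C\prod_j\|f_j\|_{L^{p_j}(X_j)},$$ with $\mathbf{BL}=\infty$ if there is no such finite $C$. \textbf{Theorem.} Let $G,G_1,\dots,G_J$ be homogeneous groups with homogeneous dimensions $Q,Q_1,\dots,Q_J$, such that $G$ is a closed subgroup of $G_1\times\dots\times G_J$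 (as a topological group), and let $\sigma_j\colon G\to G_j$ be the restrictions to $G$ of the coordinate projections. Suppose that $\sigma_j\circ\delta_t=\delta_t\circ\sigma_j$ for all $j$ and all $t>0$. Let $p_1,\dots,p_J\in[1,\infty]$ satisfy $Q=\sum_j Q_j/p_j$ (with $1/\infty=0$). Equip $G$ and the $G_j$ with Haar measures, and the Lie algebras $\mathfrak g$, $\mathfrak g_j$ with the Lebesgue measures normalised so that the Radon--Nikodym derivatives of the exponential maps $\exp_G$, $\exp_{G_j}$ take the value $1$ at $0$. Then each $\sigma_j$ is differentiable at the identity, so that $\mathrm d\sigma_j\colon\mathfrak g\to\mathfrak g_j$ is a well-defined linear map, and $$\mathbf{BL}(G,\boldsymbol\sigma,\boldsymbol p)=\mathbf{BL}(\mathfrak g,\mathbf{d}\boldsymbol\sigma,\boldsymbol p).$$ -/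

import Mathlib

open scoped Manifold ContDiff ENNReal Topology
open MeasureTheory

namespace BrascampLieb

noncomputable section

/-! ### The Brascamp–Lieb constant -/

section BL

variable {ι : Type*} [Fintype ι] {X : Type*} [MeasurableSpace X]
  {Y : ι → Type*} [∀ j, TopologicalSpace (Y j)] [∀ j, MeasurableSpace (Y j)]

/-- The Brascamp–Lieb inequality with constant `C`: for all inputs `f j ∈ C_c(Y j)` the product
`∏ j, f j ∘ σ j` is integrable and `|∫ ∏ j, f j ∘ σ j| ≤ C * ∏ j, ‖f j‖_{p j}`. -/
def IsBound (μ : Measure X) (ν : ∀ j, Measure (Y j)) (σ : ∀ j, X → Y j) (p : ι → ℝ≥0∞)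
    (C : ℝ≥0∞) : Prop :=
  ∀ f : ∀ j, Y j → ℂ, (∀ j, Continuous (f j)) → (∀ j, HasCompactSupport (f j)) →
    Integrable (fun x => ∏ j, f j (σ j x)) μ ∧
      ‖∫ x, ∏ j, f j (σ j x) ∂μ‖ₑ ≤ C * ∏ j, eLpNorm (f j) (p j) (ν j)

/-- The Brascamp–Lieb constant: the best constant in the Brascamp–Lieb inequality, equal to `∞`
if there is no such inequality with a finite constant. -/
def blConst (μ : Measure X) (ν : ∀ j, Measure (Y j)) (σ : ∀ j, X → Y j) (p : ι → ℝ≥0∞) : ℝ≥0∞ :=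
  sInf {C : ℝ≥0∞ | IsBound μ ν σ p C}

end BL

/-! ### Lie groups: Lie algebra, differential of a homomorphism, exponential map -/

/-- Tangent spaces carry their Borel `σ`-algebra. -/
instance instMeasurableSpaceTangentSpace {E : Type*} [NormedAddCommGroup E] [NormedSpace ℝ E]
    {G : Type*} [TopologicalSpace G] [ChartedSpace E G] (x : G) :
    MeasurableSpace (TangentSpace 𝓘(ℝ, E) x) := borel _

instance instBorelSpaceTangentSpace {E : Type*} [NormedAddCommGroup E] [NormedSpace ℝ E]
    {G : Type*} [TopologicalSpace G] [ChartedSpace E G] (x : G) :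
    BorelSpace (TangentSpace 𝓘(ℝ, E) x) := ⟨rfl⟩

section LieGroups

variable {E : Type*} [NormedAddCommGroup E] [NormedSpace ℝ E]
  {G : Type*} [TopologicalSpace G] [ChartedSpace E G] [Group G]
  {F : Type*} [NormedAddCommGroup F] [NormedSpace ℝ F]
  {H : Type*} [TopologicalSpace H] [ChartedSpace F H] [Group H]

/-- The differential `dσ : 𝔤 → 𝔥` of a homomorphism `σ : G → H`, i.e. the derivative of `σ` at the
identity (the tangent space of `H` at `σ 1` is the one at `1`, as `σ 1 = 1`). -/
def lieDiff (σ : G →* H) : GroupLieAlgebra 𝓘(ℝ, E) G →L[ℝ] GroupLieAlgebra 𝓘(ℝ, F) H :=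
  mfderiv 𝓘(ℝ, E) 𝓘(ℝ, F) σ 1

open Classical in
/-- The exponential map `𝔤 → G`: `lieExp X = γ 1`, where `γ` is the integral curve of the
left-invariant vector field of `X` with `γ 0 = 1`. (In a Lie group this curve exists on all of `ℝ`
and is unique.) -/
def lieExp (X : GroupLieAlgebra 𝓘(ℝ, E) G) : G :=
  if h : ∃ γ : ℝ → G, γ 0 = 1 ∧
      IsMIntegralCurve (I := 𝓘(ℝ, E)) γ (mulInvariantVectorField X) then h.choose 1 else 1

/-- The measures `μ` on `G` and `ν` on `𝔤` are compatibly normalised: near `0` the exponential map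
has a continuous Radon–Nikodym derivative `J` (with `μ (exp s) = ∫_s J dν`), and `J 0 = 1`. -/
def ExpNormalized [MeasurableSpace G] (μ : Measure G) (ν : Measure (GroupLieAlgebra 𝓘(ℝ, E) G)) : Prop :=
  ∃ U ∈ 𝓝 (0 : GroupLieAlgebra 𝓘(ℝ, E) G), ∃ J : GroupLieAlgebra 𝓘(ℝ, E) G → ℝ≥0∞,
    ContinuousOn J U ∧ J 0 = 1 ∧
      ∀ s ⊆ U, MeasurableSet s → μ (lieExp '' s) = ∫⁻ X in s, J X ∂ν

end LieGroups

/-! ### Homogeneous groups -/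

section Homogeneous

variable (E : Type*) [NormedAddCommGroup E] [NormedSpace ℝ E]
  (G : Type*) [TopologicalSpace G] [ChartedSpace E G] [Group G]

/-- A dilation matrix on the Lie algebra `𝔤` of `G`: a derivation that is diagonalisable with
positive (real) eigenvalues. -/
structure DilationMatrix where
  /-- the underlying linear map -/
  toLin : GroupLieAlgebra 𝓘(ℝ, E) G →ₗ[ℝ] GroupLieAlgebra 𝓘(ℝ, E) G
  leibniz : ∀ X Y : GroupLieAlgebra 𝓘(ℝ, E) G, toLin ⁅X, Y⁆ = ⁅toLin X, Y⁆ + ⁅X, toLin Y⁆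
  diagonalizable : ⨆ d : ℝ, Module.End.eigenspace toLin d = ⊤
  eigenvalue_pos : ∀ d : ℝ, Module.End.HasEigenvalue toLin d → 0 < d

/-- The structure of a homogeneous group on a (connected, simply connected) Lie group `G`: a
dilation matrix `Λ` on `𝔤`, which defines the dilations `t ^ Λ = exp (Λ log t)` of `𝔤`
(multiplication by `t ^ d` on the eigenspace of `Λ` for `d`), together with the corresponding
dilations of `G`, i.e. the automorphisms `dil t` of `G` (`t > 0`) with differential `t ^ Λ`.
As `G` is connected and simply connected, `dil t` exists, is determined by `Λ`, and equals
`exp ∘ t ^ Λ ∘ log`. -/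
structure HomogeneousStructure extends DilationMatrix E G where
  /-- the dilations of the group, of interest for `t > 0` only -/
  dil : ℝ → G ≃* G
  contMDiff_dil : ∀ t : ℝ, 0 < t → ContMDiff 𝓘(ℝ, E) 𝓘(ℝ, E) ∞ (dil t)
  lieDiff_dil : ∀ t : ℝ, 0 < t → ∀ (d : ℝ) (X : GroupLieAlgebra 𝓘(ℝ, E) G),
    toLin X = d • X → lieDiff (dil t : G →* G) X = t ^ d • X

variable {E G}

/-- The homogeneous dimension `Q = trace Λ`, the sum of the eigenvalues of `Λ`. -/
def HomogeneousStructure.homDim (D : HomogeneousStructure E G) : ℝ :=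
  LinearMap.trace ℝ (GroupLieAlgebra 𝓘(ℝ, E) G) D.toLin

end Homogeneous

/-- The datum given by the homomorphisms `σ j : G → Gs j` is canonical: through `x ↦ (σ j x)_j` the
topological group `G` is a closed subgroup of the product group `∏ j, Gs j`, so that the `σ j` are
the restrictions to `G` of the coordinate projections. -/
def IsCanonical {ι : Type*} {G : Type*} [TopologicalSpace G] [Group G] {Gs : ι → Type*}
    [∀ j, TopologicalSpace (Gs j)] [∀ j, Group (Gs j)] (σ : ∀ j, G →* Gs j) : Prop :=
  Topology.IsClosedEmbedding (fun (x : G) (j : ι) => σ j x)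

end

end BrascampLieb

/-! On a homogeneous group the exponential map is a global change of variables that turns the group
datum into the Lie algebra datum, so the two constants agree. Three facts about `exp` carry this.

It is a homeomorphism (`isHomeomorph_expMap`). In a chart it is the time-one map of an ODE depending
on a parameter, with strict derivative the identity at `0`, hence a local homeomorphism there. Since
`exp ∘ t^Λ = δ_t ∘ exp` and `t^Λ X → 0`, `δ_t x → 1` as `t → 0`, dilations spread this local
statement over the whole group.

It conjugates `dσ` to `σ` (`expHomeomorph_lieDiff`). Homomorphisms map one-parameter subgroups to
one-parameter subgroups. Differentiability of a continuous `σ` follows from `X + Y = lim n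
log(exp(X/n) exp(Y/n))`: `log ∘ σ ∘ exp` is additive and continuous, hence linear.

It carries Lebesgue measure to Haar measure (`measurePreserving_expHomeomorph`). Dilations scale
both measures by constants, and near the identity the measures are comparable with ratio arbitrarily
close to one; contracting any bounded set into that region forces equality. -/

namespace BrascampLieb

/-! ### Left-invariant vector fields and one-parameter subgroups -/

section IntegralCurves

theorem comp_one_smulRight {E F : Type*} [NormedAddCommGroup E] [NormedSpace ℝ E]
    [NormedAddCommGroup F] [NormedSpace ℝ F] (A : E →L[ℝ] F) (v : E) :
    A.comp ((1 : ℝ →L[ℝ] ℝ).smulRight v) = (1 : ℝ →L[ℝ] ℝ).smulRight (A v) := by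
  ext; simp

variable {E : Type*} [NormedAddCommGroup E] [NormedSpace ℝ E]
  {G : Type*} [TopologicalSpace G] [ChartedSpace E G] [Group G] [LieGroup 𝓘(ℝ, E) ∞ G]
  {F : Type*} [NormedAddCommGroup F] [NormedSpace ℝ F]
  {H : Type*} [TopologicalSpace H] [ChartedSpace F H] [Group H] [LieGroup 𝓘(ℝ, F) ∞ H]

theorem mdifferentiableAt_mul_left (g h : G) :
    MDifferentiableAt 𝓘(ℝ, E) 𝓘(ℝ, E) (g * ·) h :=
  (contMDiff_mul_left (I := 𝓘(ℝ, E)) (n := ∞)).contMDiffAt.mdifferentiableAt (by simp)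

theorem mfderiv_mul_left_mulInvariantVectorField (g h : G) (X : GroupLieAlgebra 𝓘(ℝ, E) G) :
    mfderiv 𝓘(ℝ, E) 𝓘(ℝ, E) (g * ·) h (mulInvariantVectorField X h) =
      mulInvariantVectorField X (g * h) := by
  have hc : (g * h * ·) = (g * ·) ∘ (h * · : G → G) := by ext x; simp [mul_assoc]
  simp only [mulInvariantVectorField]
  rw [hc, mfderiv_comp_of_eq (mdifferentiableAt_mul_left g h) (mdifferentiableAt_mul_left h 1)
    (mul_one h)]
  exact (congrArg (fun u : E →L[ℝ] E =>
    u (mfderiv 𝓘(ℝ, E) 𝓘(ℝ, E) (h * · : G → G) 1 X)) (mfderiv_congr_point (mul_one h))).symm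

theorem mdifferentiableAt_hom {f : G →* H}
    (hf : MDifferentiableAt 𝓘(ℝ, E) 𝓘(ℝ, F) f 1) (g : G) :
    MDifferentiableAt 𝓘(ℝ, E) 𝓘(ℝ, F) f g := by
  have hc : (f : G → H) = (f g * ·) ∘ f ∘ (g⁻¹ * ·) := by ext x; simp
  rw [hc]
  refine (mdifferentiableAt_mul_left _ _).comp g ?_
  exact MDifferentiableAt.comp_of_eq g hf (mdifferentiableAt_mul_left _ _) (by simp)

/-- A homomorphism carries left-invariant vector fields to left-invariant vector fields. -/
theorem mfderiv_hom_mulInvariantVectorField {f : G →* H}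
    (hf : MDifferentiableAt 𝓘(ℝ, E) 𝓘(ℝ, F) f 1) (g : G) (X : GroupLieAlgebra 𝓘(ℝ, E) G) :
    mfderiv 𝓘(ℝ, E) 𝓘(ℝ, F) f g (mulInvariantVectorField X g) =
      mulInvariantVectorField (lieDiff f X) (f g) := by
  -- All tangent spaces are definitionally the model space. Equating maps between model spaces
  -- avoids transport between fibres at `g * 1` and `g`, or at `f 1` and `1`.
  have h1 : @Eq (E →L[ℝ] F) (mfderiv 𝓘(ℝ, E) 𝓘(ℝ, F) (f ∘ (g * · : G → G)) (1 : G))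
      (mfderiv 𝓘(ℝ, E) 𝓘(ℝ, F) ((f g * ·) ∘ f) (1 : G)) := by
    have hc : f ∘ (g * · : G → G) = (f g * ·) ∘ f := by ext x; simp
    rw [hc]
  rw [mfderiv_comp_of_eq (mdifferentiableAt_hom hf g) (mdifferentiableAt_mul_left g 1)
    (mul_one g), mfderiv_comp_of_eq (mdifferentiableAt_mul_left (f g) (f 1)) hf rfl] at h1
  have h2 : @Eq (E →L[ℝ] F) (mfderiv 𝓘(ℝ, E) 𝓘(ℝ, F) f (g * 1))
    (mfderiv 𝓘(ℝ, E) 𝓘(ℝ, F) f g) := mfderiv_congr_point (mul_one g)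
  have h3 : @Eq (F →L[ℝ] F) (mfderiv 𝓘(ℝ, F) 𝓘(ℝ, F) (f g * ·) (f 1))
    (mfderiv 𝓘(ℝ, F) 𝓘(ℝ, F) (f g * ·) 1) := mfderiv_congr_point (map_one f)
  have h4 := congrArg (fun u : E →L[ℝ] F => u X) h1
  exact ((congrArg (fun u : E →L[ℝ] F => u (mulInvariantVectorField X g)) h2).symm.trans h4).trans
    (congrArg (fun u : F →L[ℝ] F => u (lieDiff f X)) h3)

theorem isMIntegralCurve_hom_comp {f : G →* H}
    (hf : MDifferentiableAt 𝓘(ℝ, E) 𝓘(ℝ, F) f 1) {X : GroupLieAlgebra 𝓘(ℝ, E) G} {γ : ℝ → G}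
    (hγ : IsMIntegralCurve (I := 𝓘(ℝ, E)) γ (mulInvariantVectorField X)) :
    IsMIntegralCurve (I := 𝓘(ℝ, F)) (fun t => f (γ t)) (mulInvariantVectorField (lieDiff f X)) := by
  intro t
  refine ((mdifferentiableAt_hom hf (γ t)).hasMFDerivAt.comp t (hγ t)).congr_mfderiv ?_
  rw [← mfderiv_hom_mulInvariantVectorField hf]
  exact comp_one_smulRight (E := E) (F := F) _ _

theorem isMIntegralCurveOn_mul_left (g : G) {X : GroupLieAlgebra 𝓘(ℝ, E) G} {γ : ℝ → G} {s : Set ℝ}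
    (hγ : IsMIntegralCurveOn (I := 𝓘(ℝ, E)) γ (mulInvariantVectorField X) s) :
    IsMIntegralCurveOn (I := 𝓘(ℝ, E)) (fun t => g * γ t) (mulInvariantVectorField X) s := by
  intro t ht
  refine ((mdifferentiableAt_mul_left g (γ t)).hasMFDerivAt.comp_hasMFDerivWithinAt t
    (hγ t ht)).congr_mfderiv ?_
  rw [← mfderiv_mul_left_mulInvariantVectorField]
  exact comp_one_smulRight (E := E) (F := E) _ _

theorem contMDiff_one_mulInvariantVectorField (X : GroupLieAlgebra 𝓘(ℝ, E) G) :
    ContMDiff 𝓘(ℝ, E) 𝓘(ℝ, E).tangent 1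
      (fun g : G => (⟨g, mulInvariantVectorField X g⟩ : TangentBundle 𝓘(ℝ, E) G)) := by
  have : LieGroup 𝓘(ℝ, E) (minSmoothness ℝ 3) G :=
    LieGroup.of_le (n := ∞) (by rw [minSmoothness_of_isRCLikeNormedField]; exact ENat.LEInfty.out)
  exact (contMDiff_mulInvariantVectorField X).of_le
    (by rw [minSmoothness_of_isRCLikeNormedField]; norm_num)

variable [T2Space G]

/-- Left translates of one local curve at the identity give a curve through every point, all living
for the same time `ε`; a uniform lifetime implies completeness. -/
theorem exists_isMIntegralCurve_mulInvariantVectorField [CompleteSpace E]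
    (X : GroupLieAlgebra 𝓘(ℝ, E) G) :
    ∃ γ : ℝ → G, γ 0 = 1 ∧ IsMIntegralCurve (I := 𝓘(ℝ, E)) γ (mulInvariantVectorField X) := by
  obtain ⟨γ, hγ0, hγ⟩ := exists_isMIntegralCurveAt_of_contMDiffAt_boundaryless (t₀ := 0)
    ((contMDiff_one_mulInvariantVectorField X).contMDiffAt (x := (1 : G)))
  obtain ⟨ε, hε, h⟩ := isMIntegralCurveAt_iff'.1 hγ
  rw [Real.ball_eq_Ioo, zero_sub, zero_add] at h
  exact exists_isMIntegralCurve_of_isMIntegralCurveOn (contMDiff_one_mulInvariantVectorField X) hε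
    (fun x => ⟨fun t => x * γ t, by simp [hγ0], isMIntegralCurveOn_mul_left x h⟩) 1

/-- Integral curves of a `C^1` field are unique in a Hausdorff manifold, so the choice made in
`lieExp` is immaterial. -/
theorem lieExp_eq {X : GroupLieAlgebra 𝓘(ℝ, E) G} {γ : ℝ → G} (h0 : γ 0 = 1)
    (hγ : IsMIntegralCurve (I := 𝓘(ℝ, E)) γ (mulInvariantVectorField X)) : lieExp X = γ 1 := by
  have hex : ∃ γ : ℝ → G, γ 0 = 1 ∧
      IsMIntegralCurve (I := 𝓘(ℝ, E)) γ (mulInvariantVectorField X) := ⟨γ, h0, hγ⟩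
  rw [lieExp, dif_pos hex]
  exact congrFun (isMIntegralCurve_Ioo_eq_of_contMDiff_boundaryless (t₀ := 0)
    (contMDiff_one_mulInvariantVectorField X) hex.choose_spec.2 hγ
    (by rw [hex.choose_spec.1, h0])) 1

theorem lieExp_smul_eq {X : GroupLieAlgebra 𝓘(ℝ, E) G} {γ : ℝ → G} (h0 : γ 0 = 1)
    (hγ : IsMIntegralCurve (I := 𝓘(ℝ, E)) γ (mulInvariantVectorField X)) (s : ℝ) :
    lieExp (s • X) = γ s := by
  have h := hγ.comp_mul s
  rw [← mulInvariantVectorField_smul] at h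
  simpa using lieExp_eq (by simpa using h0) h

theorem isMIntegralCurve_lieExp [CompleteSpace E] (X : GroupLieAlgebra 𝓘(ℝ, E) G) :
    IsMIntegralCurve (I := 𝓘(ℝ, E)) (fun s : ℝ => lieExp (s • X) : ℝ → G)
      (mulInvariantVectorField X) := by
  obtain ⟨γ, h0, hγ⟩ := exists_isMIntegralCurve_mulInvariantVectorField X
  simpa only [lieExp_smul_eq h0 hγ] using hγ

theorem lieExp_zero [CompleteSpace E] : (lieExp (0 : GroupLieAlgebra 𝓘(ℝ, E) G) : G) = 1 := by
  obtain ⟨γ, h0, hγ⟩ := exists_isMIntegralCurve_mulInvariantVectorField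
    (0 : GroupLieAlgebra 𝓘(ℝ, E) G)
  simpa [h0] using lieExp_smul_eq h0 hγ 0

/-- As functions of `t`, both sides are integral curves of the same left-invariant field with the
same value at `t = 0`. -/
theorem lieExp_add_smul [CompleteSpace E] (X : GroupLieAlgebra 𝓘(ℝ, E) G) (s t : ℝ) :
    (lieExp ((s + t) • X) : G) = lieExp (s • X) * lieExp (t • X) := by
  have h1 := (isMIntegralCurve_lieExp (G := G) X).comp_add s
  have h2 := isMIntegralCurve_iff_isMIntegralCurveOn.2 (isMIntegralCurveOn_mul_left (lieExp (s • X))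
    ((isMIntegralCurve_lieExp X).isMIntegralCurveOn Set.univ))
  have := congrFun (isMIntegralCurve_Ioo_eq_of_contMDiff_boundaryless (t₀ := 0)
    (contMDiff_one_mulInvariantVectorField X) h1 h2 (by simp [lieExp_zero (G := G) (E := E)])) t
  simpa [add_comm] using this

/-- The exponential map intertwines a homomorphism and its differential. -/
theorem hom_lieExp [T2Space H] [CompleteSpace E] {f : G →* H}
    (hf : MDifferentiableAt 𝓘(ℝ, E) 𝓘(ℝ, F) f 1) (X : GroupLieAlgebra 𝓘(ℝ, E) G) :
    f (lieExp X) = lieExp (lieDiff (F := F) f X) := by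
  obtain ⟨γ, h0, hγ⟩ := exists_isMIntegralCurve_mulInvariantVectorField (G := G) X
  rw [lieExp_eq h0 hγ, lieExp_eq (γ := fun t => f (γ t)) (by simp [h0])
    (isMIntegralCurve_hom_comp hf hγ)]

end IntegralCurves

/-! ### Differentiability of an ODE endpoint in its parameter -/

section ParameterODE

variable {E : Type*} [NormedAddCommGroup E] [NormedSpace ℝ E]

/-- The mean value inequality is applied to `u - v - t (X - Y)`, whose derivative splits as `(A u -
id)(X - Y) + (A u - A v) Y`. The maximum `D` of `‖u - v‖` enters the resulting bound, and `K R ≤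
1/4` lets it be absorbed: `D ≤ 2 ‖X - Y‖`. -/
theorem norm_endpoint_sub_le {A : E → E →L[ℝ] E} {e : E} {s : Set E} {K : NNReal}
    (hA : LipschitzOnWith K A s) (hes : e ∈ s) (hAe : A e = ContinuousLinearMap.id ℝ E)
    {X Y : E} {u v : ℝ → E} {R : ℝ} (hKR : K * R ≤ 1 / 4) (hX : ‖X‖ ≤ R) (hY : ‖Y‖ ≤ R)
    (hu0 : u 0 = e) (hv0 : v 0 = e)
    (hu : ∀ t ∈ Set.Icc (0 : ℝ) 1, HasDerivAt u (A (u t) X) t ∧ u t ∈ s ∧ ‖u t - e‖ ≤ 2 * ‖X‖)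
    (hv : ∀ t ∈ Set.Icc (0 : ℝ) 1, HasDerivAt v (A (v t) Y) t ∧ v t ∈ s) :
    ‖u 1 - v 1 - (X - Y)‖ ≤ 4 * (K * R) * ‖X - Y‖ := by
  have hcont : ContinuousOn (fun t => ‖u t - v t‖) (Set.Icc (0 : ℝ) 1) := fun t ht =>
    ((hu t ht).1.continuousAt.sub (hv t ht).1.continuousAt).norm.continuousWithinAt
  obtain ⟨t₀, ht₀, hmax⟩ := isCompact_Icc.exists_isMaxOn ⟨0, by simp⟩ hcont
  set d := ‖X - Y‖
  set D := ‖u t₀ - v t₀‖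
  have hK : (0 : ℝ) ≤ K := K.2
  have hd : 0 ≤ d := norm_nonneg _
  have hD : 0 ≤ D := norm_nonneg _
  have hbound : ∀ t ∈ Set.Icc (0 : ℝ) 1, ‖u t - v t - t • (X - Y)‖ ≤
      2 * (K * R) * d + (K * R) * D := by
    have key := norm_image_sub_le_of_norm_deriv_le_segment'
      (f := fun t : ℝ => u t - v t - t • (X - Y)) (a := 0) (b := 1)
      (f' := fun t => A (u t) X - A (v t) Y - (X - Y)) (C := 2 * (K * R) * d + (K * R) * D)
      (fun t ht => by
        have := ((hu t ht).1.sub (hv t ht).1).sub ((hasDerivAt_id t).smul_const (X - Y))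
        rw [one_smul] at this
        exact this.hasDerivWithinAt)
      (fun t ht => by
        have ht' := Set.Ico_subset_Icc_self ht
        have h1 : ‖A (u t) - ContinuousLinearMap.id ℝ E‖ ≤ 2 * (K * R) := by
          rw [← hAe]
          calc ‖A (u t) - A e‖ ≤ K * ‖u t - e‖ := hA.norm_sub_le (hu t ht').2.1 hes
            _ ≤ K * (2 * R) := by gcongr; linarith [(hu t ht').2.2]
            _ = _ := by ring
        have h2 : ‖A (u t) - A (v t)‖ ≤ K * D :=
          (hA.norm_sub_le (hu t ht').2.1 (hv t ht').2).trans (by gcongr; exact hmax ht')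
        have h3 : A (u t) X - A (v t) Y - (X - Y) =
            (A (u t) - ContinuousLinearMap.id ℝ E) (X - Y) + (A (u t) - A (v t)) Y := by
          simp only [sub_apply, map_sub, ContinuousLinearMap.id_apply]
          abel
        rw [h3]
        calc _ ≤ 2 * (K * R) * d + (K * D) * R :=
              (norm_add_le _ _).trans (add_le_add (ContinuousLinearMap.le_of_opNorm_le _ h1 _)
                ((ContinuousLinearMap.le_of_opNorm_le _ h2 _).trans (by gcongr)))
          _ = _ := by ring)
    intro t ht
    have hR : 0 ≤ R := (norm_nonneg X).trans hX
    have h0 := key t ht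
    simp only [hu0, hv0, sub_self, zero_smul, sub_zero] at h0
    refine h0.trans (mul_le_of_le_one_right (by positivity) ht.2)
  have hD2 : D ≤ 2 * d := by
    have h1 := hbound t₀ ht₀
    have h2 : D ≤ ‖u t₀ - v t₀ - t₀ • (X - Y)‖ + ‖t₀ • (X - Y)‖ := by
      simpa using norm_add_le (u t₀ - v t₀ - t₀ • (X - Y)) (t₀ • (X - Y))
    have h3 : ‖t₀ • (X - Y)‖ ≤ d := by
      rw [norm_smul, Real.norm_of_nonneg ht₀.1]
      exact mul_le_of_le_one_left hd ht₀.2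
    nlinarith
  have hR : 0 ≤ R := (norm_nonneg X).trans hX
  have h1 := hbound 1 (by simp)
  rw [one_smul] at h1
  have : K * R * D ≤ K * R * (2 * d) := by gcongr
  linarith

/-- The time-one map of `u' = A(u) X`, `u(0) = e`, is strictly differentiable in the parameter `X`
at `X = 0`. -/
theorem hasStrictFDerivAt_endpoint {A : E → E →L[ℝ] E} {e : E} {s : Set E} {K : NNReal}
    (hA : LipschitzOnWith K A s) (hs : s ∈ 𝓝 e) (hAe : A e = ContinuousLinearMap.id ℝ E)
    {u : E → ℝ → E} {r : ℝ} (hr : 0 < r) (hu0 : ∀ X, u X 0 = e)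
    (hu : ∀ X, ‖X‖ < r → ∀ t ∈ Set.Icc (0 : ℝ) 1,
      HasDerivAt (u X) (A (u X t) X) t ∧ ‖u X t - e‖ ≤ 2 * ‖X‖) :
    HasStrictFDerivAt (fun X => u X 1) (ContinuousLinearMap.id ℝ E) 0 := by
  rw [hasStrictFDerivAt_iff_isLittleO]
  refine Asymptotics.IsLittleO.of_bound fun c hc => ?_
  obtain ⟨ρ, hρ, hρs⟩ := Metric.mem_nhds_iff.1 hs
  -- `R < r` makes the ODE hypotheses available, `2 R < ρ` keeps solutions in the Lipschitz region,
  -- `K R ≤ 1/4` serves the endpoint estimate, and `4 K R ≤ c` gives the required little-o bound.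
  set R := min (min (r / 2) (ρ / 4)) (min (1 / 4) (c / 4) / (K + 1)) with hR
  have hK : (0 : ℝ) ≤ K := K.2
  have hR0 : 0 < R := by positivity
  have hKR : K * R ≤ min (1 / 4) (c / 4) := by
    have h1 : R ≤ min (1 / 4) (c / 4) / (K + 1) := min_le_right _ _
    rw [le_div_iff₀ (by positivity)] at h1
    nlinarith
  have hRr : R < r := by
    have : R ≤ r / 2 := (min_le_left _ _).trans (min_le_left _ _)
    linarith
  have hRρ : 2 * R < ρ := by
    have : R ≤ ρ / 4 := (min_le_left _ _).trans (min_le_right _ _)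
    linarith
  have hmem : ∀ X : E, ‖X‖ ≤ R → ∀ t ∈ Set.Icc (0 : ℝ) 1, u X t ∈ s := fun X hX t ht =>
    hρs (by
      rw [mem_ball_iff_norm]
      linarith [(hu X (hX.trans_lt hRr) t ht).2])
  filter_upwards [prod_mem_nhds (Metric.closedBall_mem_nhds (0 : E) hR0)
    (Metric.closedBall_mem_nhds (0 : E) hR0)] with ⟨X, Y⟩ ⟨hX, hY⟩
  simp only [mem_closedBall_zero_iff] at hX hY
  refine (norm_endpoint_sub_le hA (mem_of_mem_nhds hs) hAe (hKR.trans (min_le_left _ _)) hX hY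
    (hu0 X) (hu0 Y) (fun t ht => ⟨(hu X (hX.trans_lt hRr) t ht).1, hmem X hX t ht,
      (hu X (hX.trans_lt hRr) t ht).2⟩)
    (fun t ht => ⟨(hu Y (hY.trans_lt hRr) t ht).1, hmem Y hY t ht⟩)).trans ?_
  gcongr
  linarith [hKR.trans (min_le_right _ _)]

end ParameterODE

/-! ### The group law and invariant fields in a chart at the identity -/

section ExpChart

variable {E : Type*} [NormedAddCommGroup E] [NormedSpace ℝ E]
  {G : Type*} [TopologicalSpace G] [ChartedSpace E G] [Group G]

variable (E G) in
/-- The product of `G` in the preferred chart at the identity. -/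
noncomputable def chartMul (x y : E) : E :=
  extChartAt 𝓘(ℝ, E) (1 : G)
    ((extChartAt 𝓘(ℝ, E) (1 : G)).symm x * (extChartAt 𝓘(ℝ, E) (1 : G)).symm y)

local notation "φ" => extChartAt 𝓘(ℝ, E) (1 : G)

theorem chartMul_left_eventuallyEq : chartMul E G (φ (1 : G)) =ᶠ[𝓝 (φ (1 : G))] id := by
  filter_upwards [extChartAt_target_mem_nhds (I := 𝓘(ℝ, E)) (1 : G)] with y hy
  rw [chartMul, extChartAt_to_inv, one_mul, (φ).right_inv hy, id]

theorem chartMul_right_eventuallyEq :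
    (fun x => chartMul E G x (φ (1 : G))) =ᶠ[𝓝 (φ (1 : G))] id := by
  filter_upwards [extChartAt_target_mem_nhds (I := 𝓘(ℝ, E)) (1 : G)] with y hy
  rw [chartMul, extChartAt_to_inv, mul_one, (φ).right_inv hy, id]

theorem fderiv_chartMul_one :
    fderiv ℝ (chartMul E G (φ (1 : G))) (φ (1 : G)) = ContinuousLinearMap.id ℝ E := by
  rw [chartMul_left_eventuallyEq.fderiv_eq, fderiv_id]

variable [LieGroup 𝓘(ℝ, E) ∞ G]

theorem contDiffAt_chartMul :
    ContDiffAt ℝ ∞ (Function.uncurry (chartMul E G)) (φ 1, φ 1) := by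
  rw [← contMDiffAt_iff_contDiffAt]
  have hsymm : ContMDiffAt 𝓘(ℝ, E) 𝓘(ℝ, E) ∞ (φ).symm (φ (1 : G)) :=
    (contMDiffOn_extChartAt_symm (1 : G)).contMDiffAt (extChartAt_target_mem_nhds (1 : G))
  have h1 : ContMDiffAt 𝓘(ℝ, E × E) 𝓘(ℝ, E) ∞ (fun z : E × E => (φ).symm z.1)
      (φ (1 : G), φ (1 : G)) :=
    ContMDiffAt.comp (I' := 𝓘(ℝ, E)) (φ (1 : G), φ (1 : G)) hsymm contDiff_fst.contMDiff.contMDiffAt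
  have h2 : ContMDiffAt 𝓘(ℝ, E × E) 𝓘(ℝ, E) ∞ (fun z : E × E => (φ).symm z.2)
      (φ (1 : G), φ (1 : G)) :=
    ContMDiffAt.comp (I' := 𝓘(ℝ, E)) (φ (1 : G), φ (1 : G)) hsymm contDiff_snd.contMDiff.contMDiffAt
  have h3 := h1.mul h2
  exact ContMDiffAt.comp_of_eq (I' := 𝓘(ℝ, E)) (contMDiffAt_extChartAt (x := (1 : G))) h3
    (by simp)

theorem contDiffAt_fderiv_chartMul :
    ContDiffAt ℝ 1 (fun x => fderiv ℝ (chartMul E G x) (φ (1 : G))) (φ (1 : G)) :=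
  ContDiffAt.fderiv (n := ∞) contDiffAt_chartMul contDiffAt_const (by norm_cast)

/-- Left-invariant vector fields in the preferred chart at the identity. -/
theorem mfderiv_extChartAt_mulInvariantVectorField {g : G} (hg : g ∈ (φ).source) (X : E) :
    (mfderiv 𝓘(ℝ, E) 𝓘(ℝ, E) φ g (mulInvariantVectorField (X : GroupLieAlgebra 𝓘(ℝ, E) G) g) : E) =
      fderiv ℝ (chartMul E G (φ g)) (φ (1 : G)) X := by
  have h1 : MDifferentiableAt 𝓘(ℝ, E) 𝓘(ℝ, E) φ g :=
    mdifferentiableAt_extChartAt (by simpa using hg)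
  have h2 : @Eq (E →L[ℝ] E) (mfderiv 𝓘(ℝ, E) 𝓘(ℝ, E) (φ ∘ (g * ·)) (1 : G))
      ((mfderiv 𝓘(ℝ, E) 𝓘(ℝ, E) φ g).comp (mfderiv 𝓘(ℝ, E) 𝓘(ℝ, E) (g * ·) (1 : G))) := by
    rw [mfderiv_comp_of_eq h1 (mdifferentiableAt_mul_left g 1) (mul_one g)]
    exact congrArg (fun u : E →L[ℝ] E =>
      u.comp (mfderiv 𝓘(ℝ, E) 𝓘(ℝ, E) (g * · : G → G) 1)) (mfderiv_congr_point (mul_one g))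
  have h3 : MDifferentiableAt 𝓘(ℝ, E) 𝓘(ℝ, E) (φ ∘ (g * ·)) (1 : G) :=
    h1.comp_of_eq (1 : G) (mdifferentiableAt_mul_left g 1) (mul_one g)
  have h4 : @Eq (E →L[ℝ] E) (mfderiv 𝓘(ℝ, E) 𝓘(ℝ, E) (φ ∘ (g * ·)) (1 : G))
      (fderiv ℝ (chartMul E G (φ g)) (φ (1 : G))) := by
    refine h3.mfderiv.trans ?_
    simp only [writtenInExtChartAt, extChartAt_model_space_eq_id, modelWithCornersSelf_coe,
      Set.range_id, fderivWithin_univ]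
    congr 1
    ext x
    simp only [chartMul, (φ).left_inv hg, Function.comp_apply, PartialEquiv.refl_coe, id]
  exact (congrArg (fun u : E →L[ℝ] E => u X) (h2.symm.trans h4))

/-- In the chart the curve solves `x' = A(x) X`, where `A(x)` is the derivative of the product in
its second variable at the identity. This is the ODE of the previous part. -/
theorem hasDerivAt_extChartAt_comp_isMIntegralCurve {X : E} {γ : ℝ → G}
    (hγ : IsMIntegralCurve (I := 𝓘(ℝ, E)) γ
      (mulInvariantVectorField (X : GroupLieAlgebra 𝓘(ℝ, E) G)))
    {t : ℝ} (ht : γ t ∈ (φ).source) :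
    HasDerivAt (fun s => φ (γ s)) (fderiv ℝ (chartMul E G (φ (γ t))) (φ (1 : G)) X) t := by
  have h1 : MDifferentiableAt 𝓘(ℝ, E) 𝓘(ℝ, E) φ (γ t) :=
    mdifferentiableAt_extChartAt (by simpa using ht)
  have h2 : ∀ (A : E →L[ℝ] E) (v : E),
      HasFDerivAt (φ ∘ γ) (A.comp ((1 : ℝ →L[ℝ] ℝ).smulRight v)) t →
      HasDerivAt (φ ∘ γ) (A v) t := by
    intro A v h
    rw [comp_one_smulRight] at h
    simpa using h.hasDerivAt
  rw [← mfderiv_extChartAt_mulInvariantVectorField ht]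
  exact h2 _ _ (h1.hasMFDerivAt.comp t (hγ t)).hasFDerivAt

/-- An integral curve of a left-invariant vector field with small velocity stays in the chart at
the identity up to time one. -/
theorem exists_forall_isMIntegralCurve_norm_le [T2Space G] [FiniteDimensional ℝ E] :
    ∃ r > 0, ∀ (X : E) (γ : ℝ → G), ‖X‖ < r → γ 0 = 1 →
      IsMIntegralCurve (I := 𝓘(ℝ, E)) γ
        (mulInvariantVectorField (X : GroupLieAlgebra 𝓘(ℝ, E) G)) →
      ∀ t ∈ Set.Icc (0 : ℝ) 1, γ t ∈ (φ).source ∧ ‖φ (γ t) - φ (1 : G)‖ ≤ 2 * ‖X‖ := by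
  have hA : ∀ᶠ x in 𝓝 (φ (1 : G)),
      ‖fderiv ℝ (chartMul E G x) (φ (1 : G)) - ContinuousLinearMap.id ℝ E‖ < 1 / 2 := by
    have hc := (contDiffAt_fderiv_chartMul (E := E) (G := G)).continuousAt
    refine (hc.sub (continuousAt_const (y := ContinuousLinearMap.id ℝ E))).norm.eventually_lt
      continuousAt_const ?_
    change ‖fderiv ℝ (chartMul E G (φ (1 : G))) (φ (1 : G)) - ContinuousLinearMap.id ℝ E‖ < 1 / 2
    rw [fderiv_chartMul_one, sub_self, norm_zero]
    norm_num
  obtain ⟨ρ, hρ, hρA⟩ := Metric.eventually_nhds_iff.1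
    (hA.and (extChartAt_target_mem_nhds (I := 𝓘(ℝ, E)) (1 : G)))
  refine ⟨ρ / 2, by positivity, fun X γ hX h0 hγ => ?_⟩
  -- The strict slack used below is a multiple of `‖X‖`, so the constant curve is treated apart.
  by_cases hX0 : X = 0
  · intro t _
    have hγt : γ t = 1 := by
      have h1 := lieExp_smul_eq h0 hγ t
      have h2 := lieExp_smul_eq h0 hγ 0
      have h3 : t • (X : GroupLieAlgebra 𝓘(ℝ, E) G) = (0 : ℝ) • X := by simp [hX0]
      exact h1.symm.trans ((congrArg _ h3).trans (h2.trans h0))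
    simp [hγt]
  have hball : Metric.closedBall (φ (1 : G)) (2 * ‖X‖) ⊆ (φ).target := fun y hy =>
    (hρA (lt_of_le_of_lt hy (by linarith))).2
  set C := (φ).symm '' Metric.closedBall (φ (1 : G)) (2 * ‖X‖) with hC
  have hCclosed : IsClosed C :=
    ((isCompact_closedBall _ _).image_of_continuousOn
      ((continuousOn_extChartAt_symm (1 : G)).mono hball)).isClosed
  have hCsource : C ⊆ (φ).source := by
    rintro _ ⟨y, hy, rfl⟩
    exact (φ).map_target (hball hy)
  set S : Set ℝ := {t | γ t ∈ C ∧ ‖φ (γ t) - φ (1 : G)‖ ≤ 2 * ‖X‖ * t} with hS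
  -- Continuous induction: `S` is closed in the interval, contains `0`, and can be prolonged to the
  -- right of each of its points before `1`. The compact set `C` prevents escape from the chart.
  have hsub : Set.Icc (0 : ℝ) 1 ⊆ S := by
    refine IsClosed.Icc_subset_of_forall_exists_gt ?_ ?_ ?_
    · have h1 : IsClosed {t | t ∈ γ ⁻¹' C ∧ ‖φ (γ t) - φ (1 : G)‖ ≤ 2 * ‖X‖ * t} := by
        refine IsClosed.isClosed_le (hCclosed.preimage hγ.continuous) ?_ (by fun_prop)
        refine ContinuousOn.norm (ContinuousOn.sub ?_ continuousOn_const)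
        exact (continuousOn_extChartAt (1 : G)).comp hγ.continuous.continuousOn
          fun t ht => hCsource ht
      exact h1.inter isClosed_Icc
    · refine ⟨⟨φ (1 : G), by simp, ?_⟩, by simp [h0]⟩
      rw [extChartAt_to_inv, h0]
    · rintro t ⟨⟨htC, ht⟩, ht0, ht1⟩ y hy
      have hd := hasDerivAt_extChartAt_comp_isMIntegralCurve hγ (hCsource htC)
      set v := fderiv ℝ (chartMul E G (φ (γ t))) (φ (1 : G)) X with hv
      have hXpos : 0 < ‖X‖ := norm_pos_iff.2 hX0
      have hv_le : ‖v‖ ≤ 3 / 2 * ‖X‖ := by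
        have h1 := (hρA (y := φ (γ t)) (by rw [dist_eq_norm]; nlinarith)).1
        have h2 : v = (fderiv ℝ (chartMul E G (φ (γ t))) (φ (1 : G)) -
            ContinuousLinearMap.id ℝ E) X + X := by simp [hv]
        rw [h2]
        have h3 := ContinuousLinearMap.le_of_opNorm_le _ h1.le X
        linarith [norm_add_le ((fderiv ℝ (chartMul E G (φ (γ t))) (φ (1 : G)) -
            ContinuousLinearMap.id ℝ E) X) X]
      -- The velocity is at most `3/2 ‖X‖`; an error of slope `‖X‖ / 2` keeps the total slope within
      -- `2 ‖X‖`.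
      have hev1 : ∀ᶠ u in 𝓝[>] t, ‖φ (γ u) - φ (γ t) - (u - t) • v‖ ≤ ‖X‖ / 2 * ‖u - t‖ :=
        ((hasDerivAt_iff_isLittleO.1 hd).bound (by positivity)).filter_mono nhdsWithin_le_nhds
      have hev2 : ∀ᶠ u in 𝓝[>] t, γ u ∈ (φ).source :=
        (hγ.continuous.continuousAt.eventually
          ((isOpen_extChartAt_source (1 : G)).mem_nhds (hCsource htC))).filter_mono
            nhdsWithin_le_nhds
      have hev3 : ∀ᶠ u in 𝓝[>] t, u ∈ Set.Ioc t (min y 1) :=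
        Ioc_mem_nhdsGT (lt_min hy ht1)
      obtain ⟨u, hu1, hu2, hu3, hu4⟩ := (hev1.and (hev2.and hev3)).exists
      have hut : 0 < u - t := sub_pos.2 hu3
      have hle : ‖φ (γ u) - φ (1 : G)‖ ≤ 2 * ‖X‖ * u := by
        rw [Real.norm_of_nonneg hut.le] at hu1
        have h2 : ‖(u - t) • v‖ ≤ (u - t) * (3 / 2 * ‖X‖) := by
          rw [norm_smul, Real.norm_of_nonneg hut.le]
          gcongr
        have h3 : φ (γ u) - φ (1 : G) = (φ (γ u) - φ (γ t) - (u - t) • v) + (u - t) • v +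
          (φ (γ t) - φ (1 : G)) := by abel
        rw [h3]
        refine (norm_add₃_le ..).trans ?_
        nlinarith
      refine ⟨u, ⟨⟨φ (γ u), ?_, (φ).left_inv hu2⟩, hle⟩, hu3, hu4.trans (min_le_left _ _)⟩
      rw [mem_closedBall_iff_norm]
      nlinarith [hu4.trans (min_le_right _ _)]
  intro t ht
  have := hsub ht
  exact ⟨hCsource this.1, this.2.trans (by nlinarith [norm_nonneg X, ht.2])⟩

end ExpChart

/-! ### The exponential map near the origin -/

section LocalExp

variable {E : Type*} [NormedAddCommGroup E] [NormedSpace ℝ E]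
  {G : Type*} [TopologicalSpace G] [ChartedSpace E G] [Group G]

variable (E G) in
/-- The exponential map, as a function on the model space. -/
noncomputable def expMap (X : E) : G := lieExp (X : GroupLieAlgebra 𝓘(ℝ, E) G)

local notation "φ" => extChartAt 𝓘(ℝ, E) (1 : G)

variable [LieGroup 𝓘(ℝ, E) ∞ G]

theorem mdifferentiableAt_of_comp_extChartAt_symm {f : G → E}
    (hf : DifferentiableAt ℝ (fun x => f ((φ).symm x)) (φ (1 : G))) :
    MDifferentiableAt 𝓘(ℝ, E) 𝓘(ℝ, E) f 1 := by
  have h1 : MDifferentiableAt 𝓘(ℝ, E) 𝓘(ℝ, E) φ (1 : G) :=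
    mdifferentiableAt_extChartAt (by simp)
  have h2 := hf.mdifferentiableAt.comp (1 : G) h1
  refine h2.congr_of_eventuallyEq ?_
  filter_upwards [extChartAt_source_mem_nhds (I := 𝓘(ℝ, E)) (1 : G)] with x hx
  exact congrArg f ((φ).left_inv hx).symm

variable [T2Space G] [FiniteDimensional ℝ E]

theorem expMap_zero : expMap E G 0 = 1 :=
  have := FiniteDimensional.complete ℝ E
  lieExp_zero

theorem isMIntegralCurve_expMap (X : E) :
    IsMIntegralCurve (I := 𝓘(ℝ, E)) (fun s : ℝ => expMap E G (s • X))
      (mulInvariantVectorField (X : GroupLieAlgebra 𝓘(ℝ, E) G)) :=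
  have := FiniteDimensional.complete ℝ E
  isMIntegralCurve_lieExp (G := G) (X : GroupLieAlgebra 𝓘(ℝ, E) G)

theorem expMap_add_smul (X : E) (s t : ℝ) :
    expMap E G ((s + t) • X) = expMap E G (s • X) * expMap E G (t • X) :=
  have := FiniteDimensional.complete ℝ E
  lieExp_add_smul (G := G) (X : GroupLieAlgebra 𝓘(ℝ, E) G) s t

theorem expMap_nsmul (X : E) (n : ℕ) : expMap E G ((n : ℝ) • X) = expMap E G X ^ n := by
  induction n with
  | zero => simp [expMap_zero]
  | succ n ih => rw [Nat.cast_succ, expMap_add_smul, ih, one_smul, pow_succ]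

theorem exists_forall_expMap_mem_source :
    ∃ r > 0, ∀ X : E, ‖X‖ < r → ∀ t ∈ Set.Icc (0 : ℝ) 1,
      expMap E G (t • X) ∈ (φ).source ∧ ‖φ (expMap E G (t • X)) - φ (1 : G)‖ ≤ 2 * ‖X‖ := by
  obtain ⟨r, hr, h⟩ := exists_forall_isMIntegralCurve_norm_le (E := E) (G := G)
  exact ⟨r, hr, fun X hX => h X _ hX (by simp [expMap_zero]) (isMIntegralCurve_expMap X)⟩

/-- The chart image of `exp X` is the time-one value of the ODE with parameter `X`. Strict
differentiability is what the inverse function theorem needs. -/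
theorem hasStrictFDerivAt_extChartAt_expMap :
    HasStrictFDerivAt (fun X : E => φ (expMap E G X)) (ContinuousLinearMap.id ℝ E) 0 := by
  obtain ⟨r, hr, h⟩ := exists_forall_expMap_mem_source (E := E) (G := G)
  obtain ⟨K, s, hs, hK⟩ := (contDiffAt_fderiv_chartMul (E := E) (G := G)).exists_lipschitzOnWith
  simpa using hasStrictFDerivAt_endpoint (u := fun X t => φ (expMap E G (t • X))) hK hs
    fderiv_chartMul_one hr (by simp [expMap_zero])
    fun X hX t ht => ⟨hasDerivAt_extChartAt_comp_isMIntegralCurve (isMIntegralCurve_expMap X)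
      (h X hX t ht).1, (h X hX t ht).2⟩

/-- The exponential map is a local homeomorphism at `0`, and its local inverse has derivative the
identity in the preferred chart at the identity. -/
theorem exists_openPartialHomeomorph_expMap :
    ∃ Φ : OpenPartialHomeomorph E G, (0 : E) ∈ Φ.source ∧ (∀ X ∈ Φ.source, Φ X = expMap E G X) ∧
      HasFDerivAt (fun x => Φ.symm ((φ).symm x)) (ContinuousLinearMap.id ℝ E) (φ (1 : G)) := by
  have := FiniteDimensional.complete ℝ E
  obtain ⟨r, hr, h⟩ := exists_forall_expMap_mem_source (E := E) (G := G)
  have hd : HasStrictFDerivAt (fun X : E => φ (expMap E G X))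
      ((ContinuousLinearEquiv.refl ℝ E : E ≃L[ℝ] E) : E →L[ℝ] E) 0 :=
    hasStrictFDerivAt_extChartAt_expMap
  set e := hd.toOpenPartialHomeomorph (fun X : E => φ (expMap E G X)) with he
  have hecoe : ∀ X, e X = φ (expMap E G X) := fun X => rfl
  have he0 : (0 : E) ∈ e.source := hd.mem_toOpenPartialHomeomorph_source
  have hsrc : ∀ X ∈ Metric.ball (0 : E) r, expMap E G X ∈ (φ).source := fun X hX => by
    simpa using (h X (by simpa using hX) 1 (by simp)).1
  refine ⟨(e.trans (chartAt E (1 : G)).symm).restrOpen (Metric.ball 0 r) Metric.isOpen_ball,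
    ?_, ?_, ?_⟩
  · simp [hr, he0, hecoe, expMap_zero]
  · intro X hX
    simp only [OpenPartialHomeomorph.restrOpen_source, Set.mem_inter_iff] at hX
    have := (φ).left_inv (hsrc X hX.2)
    simpa [hecoe] using this
  · have h1 := hd.to_localInverse.hasFDerivAt
    simp only [expMap_zero] at h1
    refine h1.congr_of_eventuallyEq ?_
    filter_upwards [extChartAt_target_mem_nhds (I := 𝓘(ℝ, E)) (1 : G)] with x hx
    have := (φ).right_inv hx
    simp at this
    simp [this, HasStrictFDerivAt.localInverse, he]

theorem mdifferentiableAt_expMap : MDifferentiableAt 𝓘(ℝ, E) 𝓘(ℝ, E) (expMap E G) 0 := by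
  obtain ⟨r, hr, h⟩ := exists_forall_expMap_mem_source (E := E) (G := G)
  have hsymm : ContMDiffAt 𝓘(ℝ, E) 𝓘(ℝ, E) ∞ (φ).symm (φ (1 : G)) :=
    (contMDiffOn_extChartAt_symm (1 : G)).contMDiffAt (extChartAt_target_mem_nhds (1 : G))
  have h1 : MDifferentiableAt 𝓘(ℝ, E) 𝓘(ℝ, E) (fun X : E => φ (expMap E G X)) 0 :=
    hasStrictFDerivAt_extChartAt_expMap.hasFDerivAt.differentiableAt.mdifferentiableAt
  have h2 := MDifferentiableAt.comp_of_eq (0 : E) (hsymm.mdifferentiableAt (by simp)) h1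
    (by rw [expMap_zero])
  refine h2.congr_of_eventuallyEq ?_
  filter_upwards [Metric.ball_mem_nhds (0 : E) hr] with X hX
  have := (h X (by simpa using hX) 1 (by simp)).1
  rw [one_smul] at this
  exact ((φ).left_inv this).symm

/-- The first-order term of the Baker–Campbell–Hausdorff formula. -/
theorem hasDerivAt_log_mul {f : G → E}
    (hf : HasFDerivAt (fun x => f ((φ).symm x)) (ContinuousLinearMap.id ℝ E) (φ (1 : G)))
    (X Y : E) :
    HasDerivAt (fun s : ℝ => f (expMap E G (s • X) * expMap E G (s • Y))) (X + Y) 0 := by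
  obtain ⟨r, hr, h⟩ := exists_forall_expMap_mem_source (E := E) (G := G)
  have hexp : ∀ Z : E, HasDerivAt (fun s : ℝ => φ (expMap E G (s • Z))) Z 0 := fun Z => by
    have h1 : HasDerivAt (fun s : ℝ => s • Z) Z 0 := by
      simpa using (hasDerivAt_id (0 : ℝ)).smul_const Z
    have h2 : HasFDerivAt (fun X : E => φ (expMap E G X)) (ContinuousLinearMap.id ℝ E)
        ((0 : ℝ) • Z) := by
      rw [zero_smul]; exact hasStrictFDerivAt_extChartAt_expMap.hasFDerivAt
    exact h2.comp_hasDerivAt (0 : ℝ) h1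
  -- The product restricts to the identity on each axis through the identity element, so its
  -- derivative there is addition.
  have hm : HasFDerivAt (Function.uncurry (chartMul E G))
      (ContinuousLinearMap.fst ℝ E E + ContinuousLinearMap.snd ℝ E E) (φ (1 : G), φ (1 : G)) := by
    have hd := ((contDiffAt_chartMul (E := E) (G := G)).differentiableAt (by simp)).hasFDerivAt
    set D := fderiv ℝ (Function.uncurry (chartMul E G)) (φ (1 : G), φ (1 : G))
    have hl : D.comp (ContinuousLinearMap.inl ℝ E E) = ContinuousLinearMap.id ℝ E := by
      have h1 := HasFDerivAt.comp (f := fun x => (x, φ (1 : G))) (φ (1 : G)) hd (hasFDerivAt_prodMk_left (φ (1 : G)) (φ (1 : G)))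
      exact (h1.congr_of_eventuallyEq chartMul_right_eventuallyEq.symm).unique (hasFDerivAt_id _)
    have hr : D.comp (ContinuousLinearMap.inr ℝ E E) = ContinuousLinearMap.id ℝ E := by
      have h1 := HasFDerivAt.comp (f := fun x => (φ (1 : G), x)) (φ (1 : G)) hd (hasFDerivAt_prodMk_right (φ (1 : G)) (φ (1 : G)))
      exact (h1.congr_of_eventuallyEq chartMul_left_eventuallyEq.symm).unique (hasFDerivAt_id _)
    have hD : D = ContinuousLinearMap.fst ℝ E E + ContinuousLinearMap.snd ℝ E E := by
      ext z
      · simpa using congrArg (fun u : E →L[ℝ] E => u z) hl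
      · simpa using congrArg (fun u : E →L[ℝ] E => u z) hr
    rwa [hD] at hd
  have hm' : HasDerivAt (fun s : ℝ => chartMul E G (φ (expMap E G (s • X)))
      (φ (expMap E G (s • Y)))) (X + Y) 0 := by
    have := HasFDerivAt.comp_hasDerivAt_of_eq (0 : ℝ) hm ((hexp X).prodMk (hexp Y))
      (by simp [expMap_zero])
    simpa using! this
  have hc := HasFDerivAt.comp_hasDerivAt_of_eq (0 : ℝ) hf hm'
    (by simp [expMap_zero, chartMul])
  refine HasDerivAt.congr_of_eventuallyEq (hc.congr_deriv rfl) ?_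
  have hcont : ∀ Z : E, ContinuousAt (fun s : ℝ => expMap E G (s • Z)) 0 := fun Z =>
    (isMIntegralCurve_expMap Z).continuous.continuousAt
  have htop : IsTopologicalGroup G := topologicalGroup_of_lieGroup 𝓘(ℝ, E) ∞
  have hs := extChartAt_source_mem_nhds (I := 𝓘(ℝ, E)) (1 : G)
  have e1 := (hcont X).eventually_mem (s := (φ).source) (by simpa [expMap_zero] using hs)
  have e2 := (hcont Y).eventually_mem (s := (φ).source) (by simpa [expMap_zero] using hs)
  have e3 := ((hcont X).mul (hcont Y)).eventually_mem (s := (φ).source) (by simpa [expMap_zero] using hs)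
  filter_upwards [e1, e2, e3] with s h1 h2 h3
  simp only [Function.comp_apply, chartMul]
  rw [(φ).left_inv h1, (φ).left_inv h2]
  exact congrArg f ((φ).left_inv h3).symm

end LocalExp

/-! ### Dilations, and the exponential map as a global homeomorphism -/

section Dilations

variable {E : Type*} [NormedAddCommGroup E] [NormedSpace ℝ E]
  {G : Type*} [TopologicalSpace G] [ChartedSpace E G] [Group G]

namespace HomogeneousStructure

/-- The dilations of the Lie algebra, as linear maps of the model space. -/
noncomputable def dilLin (D : HomogeneousStructure E G) (t : ℝ) : E →L[ℝ] E :=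
  lieDiff (D.dil t : G →* G)

theorem dilLin_apply_of_eigenvector (D : HomogeneousStructure E G) {t : ℝ} (ht : 0 < t) {d : ℝ}
    {X : GroupLieAlgebra 𝓘(ℝ, E) G} (hX : X ∈ Module.End.eigenspace D.toLin d) :
    D.dilLin t X = (t ^ d • X : GroupLieAlgebra 𝓘(ℝ, E) G) :=
  D.lieDiff_dil t ht d X (Module.End.mem_eigenspace_iff.1 hX)

/-- Diagonalisability as a proof principle: a linear condition on `X` need only be checked on
eigenvectors of `Λ`, where `t^Λ` is the scalar `t ^ d`. -/
theorem mem_of_eigenspace_le (D : HomogeneousStructure E G)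
    (S : Submodule ℝ (GroupLieAlgebra 𝓘(ℝ, E) G))
    (hS : ∀ d, Module.End.eigenspace D.toLin d ≤ S) (X : GroupLieAlgebra 𝓘(ℝ, E) G) : X ∈ S := by
  have : (⊤ : Submodule ℝ (GroupLieAlgebra 𝓘(ℝ, E) G)) ≤ S := by
    rw [← D.diagonalizable]
    exact iSup_le hS
  exact this trivial

theorem dilLin_dilLin_inv (D : HomogeneousStructure E G) {t : ℝ} (ht : 0 < t) (X : E) :
    D.dilLin t (D.dilLin t⁻¹ X) = X := by
  let S : Submodule ℝ (GroupLieAlgebra 𝓘(ℝ, E) G) :=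
    LinearMap.eqLocus (((D.dilLin t).comp (D.dilLin t⁻¹) : E →L[ℝ] E) : E →ₗ[ℝ] E)
      (LinearMap.id : E →ₗ[ℝ] E)
  refine D.mem_of_eigenspace_le S (fun d Y hY => ?_) X
  change D.dilLin t (D.dilLin t⁻¹ Y) = Y
  rw [D.dilLin_apply_of_eigenvector (inv_pos.2 ht) hY]
  have h1 := D.dilLin_apply_of_eigenvector ht
    ((Module.End.eigenspace D.toLin d).smul_mem (t⁻¹ ^ d) hY)
  rw [h1, smul_smul, ← Real.mul_rpow ht.le (inv_nonneg.2 ht.le), mul_inv_cancel₀ ht.ne',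
    Real.one_rpow, one_smul]

theorem tendsto_dilLin_apply (D : HomogeneousStructure E G) (X : E) :
    Filter.Tendsto (fun t => D.dilLin t X) (𝓝[>] 0) (𝓝 0) := by
  let S : Submodule ℝ E :=
    { carrier := {X | Filter.Tendsto (fun t => D.dilLin t X) (𝓝[>] 0) (𝓝 0)}
      add_mem' := fun {a b} ha hb => by simpa using Filter.Tendsto.add ha hb
      zero_mem' := by simp
      smul_mem' := fun c a ha => by simpa using Filter.Tendsto.const_smul ha c }
  refine D.mem_of_eigenspace_le S (fun d Y hY => ?_) X
  change Filter.Tendsto (fun t => D.dilLin t Y) (𝓝[>] 0) (𝓝 (0 : E))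
  by_cases hY0 : Y = 0
  · have : ∀ t, D.dilLin t Y = 0 := fun t => by rw [hY0]; exact map_zero (D.dilLin t)
    simp only [this]
    exact tendsto_const_nhds
  have hd : 0 < d := D.eigenvalue_pos d
    (Module.End.hasEigenvalue_of_hasEigenvector ⟨hY, hY0⟩)
  have h1 : Filter.Tendsto (fun t : ℝ => t ^ d) (𝓝[>] 0) (𝓝 0) := by
    have := (Real.continuousAt_rpow_const 0 d (Or.inr hd.le)).tendsto
    rw [Real.zero_rpow hd.ne'] at this
    exact this.mono_left nhdsWithin_le_nhds
  have h2 : ∀ Z : E, Filter.Tendsto (fun t : ℝ => t ^ d • Z) (𝓝[>] 0) (𝓝 0) := fun Z => by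
    simpa using h1.smul_const Z
  refine (h2 Y).congr' ?_
  filter_upwards [self_mem_nhdsWithin] with t ht
  exact (D.dilLin_apply_of_eigenvector ht hY).symm

theorem tendsto_norm_dilLin [FiniteDimensional ℝ E] (D : HomogeneousStructure E G) :
    Filter.Tendsto (fun t => ‖D.dilLin t‖) (𝓝[>] 0) (𝓝 0) := by
  obtain ⟨C, hC, h⟩ := (Module.finBasis ℝ E).exists_opNorm_le (F := E)
  have h1 : Filter.Tendsto (fun t => C * ∑ i, ‖D.dilLin t (Module.finBasis ℝ E i)‖)
      (𝓝[>] 0) (𝓝 0) := by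
    have := (tendsto_finsetSum Finset.univ fun i _ =>
      (D.tendsto_dilLin_apply (Module.finBasis ℝ E i)).norm).const_mul C
    simpa using this
  refine squeeze_zero (fun t => norm_nonneg _) (fun t => ?_) h1
  exact h (Finset.sum_nonneg fun i _ => norm_nonneg _) fun i =>
    Finset.single_le_sum (f := fun i => ‖D.dilLin t (Module.finBasis ℝ E i)‖)
      (fun i _ => norm_nonneg _) (Finset.mem_univ i)

end HomogeneousStructure

variable [LieGroup 𝓘(ℝ, E) ∞ G] [T2Space G] [FiniteDimensional ℝ E]

variable (E) in
-- The image of `exp` contains a neighbourhood of `1`, so `S` is open, hence closed, and `G` is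
-- connected. Closed-under-product properties on `G` can thus be checked on exponentials.
theorem subgroup_eq_top_of_expMap_mem [ConnectedSpace G] (S : Subgroup G)
    (hS : ∀ X, expMap E G X ∈ S) : S = ⊤ := by
  have htop : IsTopologicalGroup G := topologicalGroup_of_lieGroup 𝓘(ℝ, E) ∞
  obtain ⟨Φ, h0, hΦ, -⟩ := exists_openPartialHomeomorph_expMap (E := E) (G := G)
  have hmem : (S : Set G) ∈ 𝓝 (1 : G) := by
    refine Filter.mem_of_superset (Φ.open_target.mem_nhds ?_) fun x hx => ?_
    · simpa [hΦ 0 h0, expMap_zero] using Φ.map_source h0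
    · rw [← Φ.right_inv hx, hΦ _ (Φ.map_target hx)]
      exact hS _
  have hopen : IsOpen (S : Set G) := S.isOpen_of_mem_nhds hmem
  have hclopen : IsClopen (S : Set G) := ⟨S.isClosed_of_isOpen hopen, hopen⟩
  exact SetLike.coe_injective (hclopen.eq_univ ⟨1, S.one_mem⟩)

namespace HomogeneousStructure

theorem dil_expMap (D : HomogeneousStructure E G) {t : ℝ} (ht : 0 < t) (X : E) :
    D.dil t (expMap E G X) = expMap E G (D.dilLin t X) := by
  have := FiniteDimensional.complete ℝ E
  exact hom_lieExp (f := (D.dil t : G →* G))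
    ((D.contMDiff_dil t ht).contMDiffAt.mdifferentiableAt (by simp))
    (X : GroupLieAlgebra 𝓘(ℝ, E) G)

variable [ConnectedSpace G]

/-- The structure postulates no group law in `t`; it is recovered from the Lie algebra, and yields
continuity of the inverse dilation. -/
theorem dil_dil_inv (D : HomogeneousStructure E G) {t : ℝ} (ht : 0 < t) (x : G) :
    D.dil t (D.dil t⁻¹ x) = x := by
  have := subgroup_eq_top_of_expMap_mem E
    (MonoidHom.eqLocus ((D.dil t : G →* G).comp (D.dil t⁻¹ : G →* G)) (MonoidHom.id G))
    (fun X => by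
      change D.dil t (D.dil t⁻¹ _) = _
      rw [D.dil_expMap (inv_pos.2 ht), D.dil_expMap ht, D.dilLin_dilLin_inv ht]
      rfl)
  have hx : x ∈ (⊤ : Subgroup G) := trivial
  rw [← this] at hx
  exact hx

/-- For `t > 0`, the dilation `dil t` is an isomorphism of topological groups. -/
noncomputable def dilEquiv (D : HomogeneousStructure E G) {t : ℝ} (ht : 0 < t) : G ≃ₜ* G where
  toMulEquiv := D.dil t
  continuous_toFun := (D.contMDiff_dil t ht).continuous
  continuous_invFun := by
    refine (D.contMDiff_dil t⁻¹ (inv_pos.2 ht)).continuous.congr fun x => ?_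
    exact (MulEquiv.symm_apply_eq (D.dil t)).2 (D.dil_dil_inv ht x).symm |>.symm

/-- For `t > 0`, the dilation `dilLin t` is an isomorphism of topological vector spaces. -/
noncomputable def dilLinEquiv (D : HomogeneousStructure E G) {t : ℝ} (ht : 0 < t) : E ≃L[ℝ] E :=
  ContinuousLinearEquiv.equivOfInverse (D.dilLin t) (D.dilLin t⁻¹)
    (fun X => by simpa using D.dilLin_dilLin_inv (inv_pos.2 ht) X) (D.dilLin_dilLin_inv ht)

theorem tendsto_dil (D : HomogeneousStructure E G) (x : G) :
    Filter.Tendsto (fun t => D.dil t x) (𝓝[>] 0) (𝓝 1) := by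
  have htop : IsTopologicalGroup G := topologicalGroup_of_lieGroup 𝓘(ℝ, E) ∞
  let S : Subgroup G :=
    { carrier := {x | Filter.Tendsto (fun t => D.dil t x) (𝓝[>] 0) (𝓝 1)}
      mul_mem' := fun {a b} ha hb => by simpa using Filter.Tendsto.mul ha hb
      one_mem' := by simp
      inv_mem' := fun {a} ha => by simpa using Filter.Tendsto.inv ha }
  have hS := subgroup_eq_top_of_expMap_mem E S fun X => by
    change Filter.Tendsto (fun t => D.dil t (expMap E G X)) (𝓝[>] 0) (𝓝 1)
    have h1 : ContinuousAt (expMap E G) 0 := mdifferentiableAt_expMap.continuousAt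
    have h2 := h1.tendsto.comp (D.tendsto_dilLin_apply X)
    rw [expMap_zero] at h2
    refine h2.congr' ?_
    filter_upwards [self_mem_nhdsWithin] with t ht
    exact (D.dil_expMap ht X).symm
  have hx : x ∈ (⊤ : Subgroup G) := trivial
  rw [← hS] at hx
  exact hx

theorem isHomeomorph_expMap (D : HomogeneousStructure E G) : IsHomeomorph (expMap E G) := by
  obtain ⟨Φ, h0, hΦ, -⟩ := exists_openPartialHomeomorph_expMap (E := E) (G := G)
  have hsrc : Φ.source ∈ 𝓝 (0 : E) := Φ.open_source.mem_nhds h0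
  have htgt : Φ.target ∈ 𝓝 (1 : G) := Φ.open_target.mem_nhds (by
    simpa [hΦ 0 h0, expMap_zero] using Φ.map_source h0)
  have hev : ∀ X : E, ∀ᶠ t in 𝓝[>] (0 : ℝ), D.dilLin t X ∈ Φ.source :=
    fun X => (D.tendsto_dilLin_apply X).eventually_mem hsrc
  have hpos : ∀ᶠ t in 𝓝[>] (0 : ℝ), 0 < t := self_mem_nhdsWithin
  have hnhds : ∀ X : E, Filter.map (expMap E G) (𝓝 X) = 𝓝 (expMap E G X) := by
    intro X
    obtain ⟨t, ht, htX⟩ := (hpos.and (hev X)).exists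
    -- Conjugating by a dilation with small `t` moves `X` into the domain of the local
    -- homeomorphism. The same device gives injectivity and surjectivity.
    have hcomp : expMap E G = (D.dilEquiv ht).symm ∘ expMap E G ∘ D.dilLinEquiv ht := by
      ext Y
      exact ((D.dilEquiv ht).symm_apply_eq.2 (D.dil_expMap ht Y).symm).symm
    have hloc : Filter.map (expMap E G) (𝓝 (D.dilLinEquiv ht X)) =
        𝓝 (expMap E G (D.dilLinEquiv ht X)) := by
      have h1 := Φ.map_nhds_eq htX
      rw [hΦ _ htX] at h1
      refine (Filter.map_congr ?_).trans h1
      filter_upwards [Φ.open_source.mem_nhds htX] with Y hY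
      exact (hΦ Y hY).symm
    have h2 : Filter.map (D.dilLinEquiv ht) (𝓝 X) = 𝓝 (D.dilLinEquiv ht X) :=
      (D.dilLinEquiv ht).toHomeomorph.map_nhds_eq X
    have h3 : Filter.map (D.dilEquiv ht).symm (𝓝 (expMap E G (D.dilLinEquiv ht X))) =
        𝓝 ((D.dilEquiv ht).symm (expMap E G (D.dilLinEquiv ht X))) :=
      (D.dilEquiv ht).symm.toHomeomorph.map_nhds_eq _
    calc Filter.map (expMap E G) (𝓝 X)
        = Filter.map ((D.dilEquiv ht).symm ∘ expMap E G ∘ D.dilLinEquiv ht) (𝓝 X) := by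
          rw [← hcomp]
      _ = 𝓝 ((D.dilEquiv ht).symm (expMap E G (D.dilLinEquiv ht X))) := by
          rw [← Filter.map_map, ← Filter.map_map, h2, hloc, h3]
      _ = _ := congrArg 𝓝 (congrFun hcomp X).symm
  refine ⟨continuous_iff_continuousAt.2 fun X => (hnhds X).le,
    IsOpenMap.of_nhds_le fun X => (hnhds X).ge, ?_, ?_⟩
  · intro X Y hXY
    obtain ⟨t, ht, htX, htY⟩ := (hpos.and ((hev X).and (hev Y))).exists
    have h1 : expMap E G (D.dilLin t X) = expMap E G (D.dilLin t Y) := by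
      rw [← D.dil_expMap ht, ← D.dil_expMap ht, hXY]
    rw [← hΦ _ htX, ← hΦ _ htY] at h1
    exact (D.dilLinEquiv ht).injective (Φ.injOn htX htY h1)
  · intro x
    obtain ⟨t, ht, htx⟩ := (hpos.and ((D.tendsto_dil x).eventually_mem htgt)).exists
    refine ⟨D.dilLin t⁻¹ (Φ.symm (D.dil t x)), (D.dil t).injective ?_⟩
    rw [D.dil_expMap ht, D.dilLin_dilLin_inv ht, ← hΦ _ (Φ.map_target htx), Φ.right_inv htx]

/-- The exponential map of a homogeneous group is a homeomorphism. -/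
noncomputable def expHomeomorph (D : HomogeneousStructure E G) : E ≃ₜ G :=
  D.isHomeomorph_expMap.homeomorph

theorem expHomeomorph_apply (D : HomogeneousStructure E G) (X : E) :
    D.expHomeomorph X = expMap E G X := rfl

theorem expHomeomorph_smul (D : HomogeneousStructure E G) (X : E) (n : ℕ) :
    D.expHomeomorph ((n : ℝ) • X) = D.expHomeomorph X ^ n := expMap_nsmul X n

theorem hasFDerivAt_expHomeomorph_symm (D : HomogeneousStructure E G) :
    HasFDerivAt (fun x => D.expHomeomorph.symm ((extChartAt 𝓘(ℝ, E) (1 : G)).symm x))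
      (ContinuousLinearMap.id ℝ E) (extChartAt 𝓘(ℝ, E) (1 : G) 1) := by
  obtain ⟨Φ, h0, hΦ, hd⟩ := exists_openPartialHomeomorph_expMap (E := E) (G := G)
  refine hd.congr_of_eventuallyEq ?_
  have htgt : Φ.target ∈ 𝓝 (1 : G) := Φ.open_target.mem_nhds (by
    simpa [hΦ 0 h0, expMap_zero] using Φ.map_source h0)
  have hc := continuousAt_extChartAt_symm (I := 𝓘(ℝ, E)) (1 : G)
  have := hc.eventually_mem (s := Φ.target) (by simpa using htgt)
  filter_upwards [this] with x hx
  rw [Homeomorph.symm_apply_eq, D.expHomeomorph_apply, ← hΦ _ (Φ.map_target hx), Φ.right_inv hx]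

end HomogeneousStructure

end Dilations

/-! ### Continuous homomorphisms in exponential coordinates -/

section Homomorphisms

variable {E : Type*} [NormedAddCommGroup E] [NormedSpace ℝ E] [FiniteDimensional ℝ E]
  {G : Type*} [TopologicalSpace G] [T2Space G] [ChartedSpace E G] [Group G]
  [LieGroup 𝓘(ℝ, E) ∞ G] [ConnectedSpace G]
  {F : Type*} [NormedAddCommGroup F] [NormedSpace ℝ F] [FiniteDimensional ℝ F]
  {H : Type*} [TopologicalSpace H] [T2Space H] [ChartedSpace F H] [Group H]
  [LieGroup 𝓘(ℝ, F) ∞ H] [ConnectedSpace H]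

namespace HomogeneousStructure

theorem expHomeomorph_zero (D : HomogeneousStructure E G) : D.expHomeomorph 0 = 1 := expMap_zero

theorem expHomeomorph_symm_one (D : HomogeneousStructure E G) : D.expHomeomorph.symm 1 = 0 := by
  rw [Homeomorph.symm_apply_eq, D.expHomeomorph_zero]

/-- The addition of the Lie algebra as a limit of rescaled products in the group. -/
theorem tendsto_smul_log_mul (D : HomogeneousStructure E G) (X Y : E) :
    Filter.Tendsto (fun n : ℕ => ((n + 1 : ℕ) : ℝ) • D.expHomeomorph.symm
      (D.expHomeomorph (((n + 1 : ℕ) : ℝ)⁻¹ • X) * D.expHomeomorph (((n + 1 : ℕ) : ℝ)⁻¹ • Y)))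
      Filter.atTop (𝓝 (X + Y)) := by
  have h1 := hasDerivAt_iff_tendsto_slope_zero.1
    (hasDerivAt_log_mul D.hasFDerivAt_expHomeomorph_symm X Y)
  have h2 : Filter.Tendsto (fun n : ℕ => (((n + 1 : ℕ) : ℝ))⁻¹) Filter.atTop (𝓝[≠] 0) := by
    refine tendsto_nhdsWithin_iff.2 ⟨?_, Filter.Eventually.of_forall fun n => ?_⟩
    · simpa using tendsto_one_div_add_atTop_nhds_zero_nat (𝕜 := ℝ)
    · exact inv_ne_zero (Nat.cast_ne_zero.2 (Nat.succ_ne_zero n))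
  refine (h1.comp h2).congr fun n => ?_
  simp only [Function.comp_apply, zero_add, zero_smul, inv_inv, expMap_zero, mul_one,
    D.expHomeomorph_symm_one, sub_zero]
  rfl

/-- A homomorphism of homogeneous groups in exponential coordinates. -/
noncomputable def logConj (D : HomogeneousStructure E G) (D' : HomogeneousStructure F H)
    (σ : G →* H) (X : E) : F :=
  D'.expHomeomorph.symm (σ (D.expHomeomorph X))

variable {σ : G →* H}

theorem expHomeomorph_logConj (D : HomogeneousStructure E G) (D' : HomogeneousStructure F H)
    (X : E) :
    D'.expHomeomorph (logConj D D' σ X) = σ (D.expHomeomorph X) := by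
  simp [logConj]

theorem logConj_smul (D : HomogeneousStructure E G) (D' : HomogeneousStructure F H)
    (X : E) (n : ℕ) :
    logConj D D' σ ((n : ℝ) • X) = (n : ℝ) • logConj D D' σ X := by
  apply D'.expHomeomorph.injective
  rw [expHomeomorph_smul, expHomeomorph_logConj, expHomeomorph_logConj, expHomeomorph_smul,
    map_pow]

theorem logConj_inv_smul (D : HomogeneousStructure E G) (D' : HomogeneousStructure F H)
    (X : E) (n : ℕ) :
    logConj D D' σ (((n + 1 : ℕ) : ℝ)⁻¹ • X) = ((n + 1 : ℕ) : ℝ)⁻¹ • logConj D D' σ X := by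
  have hn : ((n + 1 : ℕ) : ℝ) ≠ 0 := Nat.cast_ne_zero.2 (Nat.succ_ne_zero n)
  rw [eq_inv_smul_iff₀ hn, ← logConj_smul, smul_inv_smul₀ hn]

theorem continuous_logConj (D : HomogeneousStructure E G) (D' : HomogeneousStructure F H)
    (hσ : Continuous σ) : Continuous (logConj D D' σ) :=
  D'.expHomeomorph.symm.continuous.comp (hσ.comp D.expHomeomorph.continuous)

/-- By continuity `logConj` passes through the limit formula for `X + Y`; it respects products,
multiplication by `n + 1` and division by `n + 1`, the only operations in that formula. -/
theorem logConj_add (D : HomogeneousStructure E G) (D' : HomogeneousStructure F H)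
    (hσ : Continuous σ) (X Y : E) :
    logConj D D' σ (X + Y) = logConj D D' σ X + logConj D D' σ Y := by
  have h1 := ((continuous_logConj D D' hσ).tendsto (X + Y)).comp (D.tendsto_smul_log_mul X Y)
  refine tendsto_nhds_unique h1 ((D'.tendsto_smul_log_mul _ _).congr fun n => ?_)
  rw [Function.comp_apply, logConj_smul, ← logConj_inv_smul, ← logConj_inv_smul,
    expHomeomorph_logConj, expHomeomorph_logConj, ← map_mul]
  congr 1
  simp [logConj]

/-- A continuous homomorphism of homogeneous groups is differentiable. -/
theorem mdifferentiableAt_of_continuous (D : HomogeneousStructure E G) (D' : HomogeneousStructure F H)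
    (hσ : Continuous σ) :
    MDifferentiableAt 𝓘(ℝ, E) 𝓘(ℝ, F) σ 1 := by
  -- A continuous additive map is real-linear; then `σ = exp ∘ L ∘ log` is differentiable at the
  -- identity.
  let L : E →L[ℝ] F := AddMonoidHom.toRealLinearMap
    { toFun := logConj D D' σ
      map_zero' := by simpa using logConj_smul D D' (σ := σ) 0 0
      map_add' := logConj_add D D' hσ } (continuous_logConj D D' hσ)
  have hlog : MDifferentiableAt 𝓘(ℝ, E) 𝓘(ℝ, E) D.expHomeomorph.symm (1 : G) :=
    mdifferentiableAt_of_comp_extChartAt_symm D.hasFDerivAt_expHomeomorph_symm.differentiableAt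
  have hL : MDifferentiableAt 𝓘(ℝ, E) 𝓘(ℝ, F) L 0 := L.differentiableAt.mdifferentiableAt
  have h1 : MDifferentiableAt 𝓘(ℝ, E) 𝓘(ℝ, F) (L ∘ D.expHomeomorph.symm) (1 : G) :=
    hL.comp_of_eq (1 : G) hlog D.expHomeomorph_symm_one
  have h2 : MDifferentiableAt 𝓘(ℝ, E) 𝓘(ℝ, F) (expMap F H ∘ L ∘ D.expHomeomorph.symm) (1 : G) :=
    MDifferentiableAt.comp_of_eq (1 : G) mdifferentiableAt_expMap h1
      (by simp [D.expHomeomorph_symm_one])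
  convert h2 using 1
  ext x
  have := expHomeomorph_logConj D D' (σ := σ) (D.expHomeomorph.symm x)
  rw [Homeomorph.apply_symm_apply] at this
  exact this.symm

/-- A continuous homomorphism of homogeneous groups is conjugate to its differential via the
exponential maps. -/
theorem expHomeomorph_lieDiff (D : HomogeneousStructure E G) (D' : HomogeneousStructure F H)
    (hσ : Continuous σ) (X : E) :
    D'.expHomeomorph (lieDiff (E := E) (F := F) σ X) = σ (D.expHomeomorph X) :=
  have := FiniteDimensional.complete ℝ E
  (hom_lieExp (mdifferentiableAt_of_continuous D D' hσ) (X : GroupLieAlgebra 𝓘(ℝ, E) G)).symm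

end HomogeneousStructure

end Homomorphisms

/-! ### Comparison of measures by contraction -/

section Measure

/-- Two measures that are multiplied by constants under contractions `T n`, and are comparable near
the centre of the contractions with constants arbitrarily close to one, satisfy `μ ≤ ν`. -/
theorem measure_le_of_contractions {E : Type*} [NormedAddCommGroup E] [ProperSpace E]
    [MeasurableSpace E] [BorelSpace E] {μ ν : Measure E} [ν.IsOpenPosMeasure]
    [IsFiniteMeasureOnCompacts ν] {T : ℕ → E → E}
    (hTm : ∀ n s, MeasurableSet s → MeasurableSet (T n '' s))
    (hT : ∀ R : ℝ, ∀ U ∈ 𝓝 (0 : E), ∃ n, T n '' Metric.closedBall 0 R ⊆ U)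
    (hμ : ∀ n, ∃ a : ℝ≥0∞, a ≠ 0 ∧ a ≠ ⊤ ∧ ∀ s, MeasurableSet s → μ (T n '' s) = a * μ s)
    (hν : ∀ n, ∃ b : ℝ≥0∞, ∀ s, MeasurableSet s → ν (T n '' s) = b * ν s)
    (hloc : ∀ c : ℝ≥0∞, 1 < c → c ≠ ⊤ → ∃ U ∈ 𝓝 (0 : E), ∀ s ⊆ U, MeasurableSet s →
      μ s ≤ c * ν s ∧ ν s ≤ c * μ s) : μ ≤ ν := by
  have hbdd : ∀ (R : ℝ) (s : Set E), s ⊆ Metric.closedBall 0 R → MeasurableSet s → μ s ≤ ν s := by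
    intro R s hsR hs
    -- One factor `c` comes from comparing the measures on the contracted `s`, and two from
    -- comparing the scaling factors, `b ≤ c² a`, by testing on a fixed ball `B`.
    have hc : ∀ c : ℝ≥0∞, 1 < c → c ≠ ⊤ → μ s ≤ c ^ 3 * ν s := by
      intro c hc hct
      obtain ⟨U, hU, h⟩ := hloc c hc hct
      obtain ⟨ρ, hρ, hρU⟩ := Metric.nhds_basis_closedBall.mem_iff.1 hU
      obtain ⟨n, hn⟩ := hT (max R ρ) U hU
      obtain ⟨a, ha0, ha, hμa⟩ := hμ n
      obtain ⟨b, hνb⟩ := hν n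
      set B := Metric.closedBall (0 : E) ρ
      have hBm : MeasurableSet B := Metric.isClosed_closedBall.measurableSet
      have hTB : T n '' B ⊆ U :=
        (Set.image_mono (Metric.closedBall_subset_closedBall (le_max_right _ _))).trans hn
      have hTs : T n '' s ⊆ U :=
        (Set.image_mono (hsR.trans (Metric.closedBall_subset_closedBall (le_max_left _ _)))).trans hn
      have h1 : a * μ s ≤ c * (b * ν s) := by
        rw [← hμa s hs, ← hνb s hs]
        exact (h _ hTs (hTm n s hs)).1
      have h2 : b * ν B ≤ c * (a * (c * ν B)) := by
        calc b * ν B = ν (T n '' B) := (hνb B hBm).symm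
          _ ≤ c * μ (T n '' B) := (h _ hTB (hTm n B hBm)).2
          _ = c * (a * μ B) := by rw [hμa B hBm]
          _ ≤ _ := by gcongr; exact (h B hρU hBm).1
      have hB0 : ν B ≠ 0 := (Metric.measure_closedBall_pos ν 0 hρ).ne'
      have hBt : ν B ≠ ⊤ := (isCompact_closedBall (0 : E) ρ).measure_lt_top.ne
      have h3 : b ≤ c * (a * c) := by
        rw [← ENNReal.mul_le_mul_iff_left hB0 hBt]
        calc b * ν B ≤ _ := h2
          _ = _ := by ring
      rw [← ENNReal.mul_le_mul_iff_right ha0 ha]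
      calc a * μ s ≤ c * (b * ν s) := h1
        _ ≤ c * (c * (a * c) * ν s) := by gcongr
        _ = _ := by ring
    have hst : ν s ≠ ⊤ :=
      ((measure_mono hsR).trans_lt (isCompact_closedBall (0 : E) R).measure_lt_top).ne
    -- Letting `c` decrease to `1` is legitimate because `ν s` is finite.
    have hlim : Filter.Tendsto (fun c : ℝ≥0∞ => c ^ 3 * ν s) (𝓝[>] 1) (𝓝 (1 ^ 3 * ν s)) :=
      (ENNReal.Tendsto.mul_const (((ENNReal.continuous_pow 3).tendsto 1)) (Or.inr hst)).mono_left
        nhdsWithin_le_nhds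
    have hne : (𝓝[>] (1 : ℝ≥0∞)).NeBot := nhdsGT_neBot_of_exists_gt ⟨2, ENNReal.one_lt_two⟩
    rw [one_pow, one_mul] at hlim
    refine ge_of_tendsto hlim ?_
    filter_upwards [Ioo_mem_nhdsGT ENNReal.one_lt_two] with c hc'
    exact hc c hc'.1 (hc'.2.trans_le le_top).ne
  refine Measure.le_iff.2 fun s hs => ?_
  have hmono : Monotone fun n : ℕ => s ∩ Metric.closedBall (0 : E) n := fun m n hmn =>
    Set.inter_subset_inter_right _ (Metric.closedBall_subset_closedBall (by exact_mod_cast hmn))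
  have hunion : s = ⋃ n : ℕ, s ∩ Metric.closedBall (0 : E) n := by
    rw [← Set.inter_iUnion, Metric.iUnion_closedBall_nat, Set.inter_univ]
  conv_lhs => rw [hunion]
  rw [hmono.measure_iUnion]
  exact iSup_le fun n => (hbdd n _ Set.inter_subset_right
    (hs.inter Metric.isClosed_closedBall.measurableSet)).trans (measure_mono Set.inter_subset_left)

end Measure

/-! ### Change of variables in the Brascamp–Lieb inequality -/

section Transport

variable {ι : Type*} [Fintype ι] {X X' : Type*} [MeasurableSpace X] [MeasurableSpace X']
  {Y Y' : ι → Type*} [∀ j, TopologicalSpace (Y j)] [∀ j, MeasurableSpace (Y j)]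
  [∀ j, TopologicalSpace (Y' j)] [∀ j, MeasurableSpace (Y' j)]
  [∀ j, BorelSpace (Y' j)]

theorem IsBound.of_conj {μ : Measure X} {μ' : Measure X'} {ν : ∀ j, Measure (Y j)}
    {ν' : ∀ j, Measure (Y' j)} {σ : ∀ j, X → Y j} {σ' : ∀ j, X' → Y' j} {p : ι → ℝ≥0∞} {C : ℝ≥0∞}
    (e : X ≃ᵐ X') (he : MeasurePreserving e μ μ') (e' : ∀ j, Y j ≃ₜ Y' j)
    (he' : ∀ j, MeasurePreserving (e' j) (ν j) (ν' j)) (hσ : ∀ j x, σ' j (e x) = e' j (σ j x))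
    (h : IsBound μ ν σ p C) : IsBound μ' ν' σ' p C := by
  intro f hf hfc
  obtain ⟨h1, h2⟩ := h (fun j => f j ∘ e' j) (fun j => (hf j).comp (e' j).continuous)
    fun j => (hfc j).comp_homeomorph (e' j)
  have hcomp : (fun x => ∏ j, (f j ∘ e' j) (σ j x)) = (fun x => ∏ j, f j (σ' j x)) ∘ e := by
    ext x
    simp [hσ]
  constructor
  · rw [hcomp] at h1
    exact (he.integrable_comp_emb e.measurableEmbedding).1 h1
  · have h3 := he.integral_comp' (fun x => ∏ j, f j (σ' j x))
    have h4 : ∫ x, ∏ j, (f j ∘ e' j) (σ j x) ∂μ = ∫ x, ∏ j, f j (σ' j x) ∂μ' := by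
      rw [← h3, hcomp]
      rfl
    have h5 : ∀ j, eLpNorm (f j ∘ e' j) (p j) (ν j) = eLpNorm (f j) (p j) (ν' j) := fun j =>
      eLpNorm_comp_measurePreserving (hf j).aestronglyMeasurable (he' j)
    rw [h4] at h2
    simpa only [h5] using h2

variable [∀ j, BorelSpace (Y j)]

/-- The Brascamp–Lieb constant is invariant under measure-preserving changes of variables. -/
theorem blConst_eq_of_conj {μ : Measure X} {μ' : Measure X'} {ν : ∀ j, Measure (Y j)}
    {ν' : ∀ j, Measure (Y' j)} {σ : ∀ j, X → Y j} {σ' : ∀ j, X' → Y' j} {p : ι → ℝ≥0∞}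
    (e : X ≃ᵐ X') (he : MeasurePreserving e μ μ') (e' : ∀ j, Y j ≃ₜ Y' j)
    (he' : ∀ j, MeasurePreserving (e' j) (ν j) (ν' j)) (hσ : ∀ j x, σ' j (e x) = e' j (σ j x)) :
    blConst μ' ν' σ' p = blConst μ ν σ p := by
  have hs : {C | IsBound μ' ν' σ' p C} = {C | IsBound μ ν σ p C} := by
    ext C
    refine ⟨fun h => IsBound.of_conj e.symm (he.symm e) (fun j => (e' j).symm) (fun j => ?_)
      (fun j x => ?_) h, fun h => h.of_conj e he e' he' hσ⟩
    · exact (he' j).symm (e' j).toMeasurableEquiv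
    · rw [Homeomorph.eq_symm_apply, ← hσ, MeasurableEquiv.apply_symm_apply]
  rw [blConst, blConst, hs]

end Transport

/-! ### Haar measure in exponential coordinates -/

section HaarMeasure

variable {E : Type*} [NormedAddCommGroup E] [NormedSpace ℝ E] [FiniteDimensional ℝ E]
  {G : Type*} [TopologicalSpace G] [T2Space G] [ChartedSpace E G] [Group G]
  [LieGroup 𝓘(ℝ, E) ∞ G] [ConnectedSpace G] [MeasurableSpace G] [BorelSpace G]

namespace HomogeneousStructure

/-- Haar measure of a homogeneous group is Lebesgue measure in exponential coordinates. -/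
theorem measurePreserving_expHomeomorph [MeasurableSpace E] [BorelSpace E]
    (D : HomogeneousStructure E G) (μ : Measure G) [μ.IsHaarMeasure] (ν : Measure E)
    [ν.IsAddHaarMeasure] {U : Set E} (hU : U ∈ 𝓝 (0 : E)) {J : E → ℝ≥0∞} (hJ : ContinuousOn J U)
    (hJ0 : J 0 = 1)
    (hJμ : ∀ s ⊆ U, MeasurableSet s → μ (expMap E G '' s) = ∫⁻ X in s, J X ∂ν) :
    MeasurePreserving D.expHomeomorph ν μ := by
  have htop : IsTopologicalGroup G := topologicalGroup_of_lieGroup 𝓘(ℝ, E) ∞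
  have := FiniteDimensional.proper_real E
  have hlc : LocallyCompactSpace G := D.expHomeomorph.symm.isClosedEmbedding.locallyCompactSpace
  set m : Measure E := μ.map D.expHomeomorph.symm with hm
  have hm_apply : ∀ s, m s = μ (expMap E G '' s) := fun s => by
    rw [hm]
    refine (D.expHomeomorph.symm.toMeasurableEquiv.map_apply s).trans (congrArg μ ?_)
    exact (D.expHomeomorph.image_eq_preimage_symm s).symm
  have hμm : m.map D.expHomeomorph = μ := by
    rw [hm, Measure.map_map D.expHomeomorph.measurable D.expHomeomorph.symm.measurable]
    simp
  have hm_fin : IsFiniteMeasureOnCompacts m :=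
    Measure.IsFiniteMeasureOnCompacts.map μ D.expHomeomorph.symm
  have hm_pos : m.IsOpenPosMeasure :=
    D.expHomeomorph.symm.continuous.isOpenPosMeasure_map D.expHomeomorph.symm.surjective
  -- Regularity holds for the locally finite measure `m` on a finite-dimensional space and is
  -- carried to `G`; the modulus of an automorphism relies on it.
  have hreg : μ.Regular := by
    rw [← hμm]
    exact Measure.Regular.map D.expHomeomorph
  set t : ℕ → ℝ := fun n => 1 / ((n : ℝ) + 1) with ht
  have htpos : ∀ n, 0 < t n := fun n => Nat.one_div_pos_of_nat
  set T : ℕ → E → E := fun n => D.dilLin (t n) with hT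
  have hTm : ∀ n s, MeasurableSet s → MeasurableSet (T n '' s) := fun n s hs =>
    (D.dilLinEquiv (htpos n)).toHomeomorph.toMeasurableEquiv.measurableSet_image.2 hs
  have hTball : ∀ R : ℝ, ∀ V ∈ 𝓝 (0 : E), ∃ n, T n '' Metric.closedBall 0 R ⊆ V := by
    intro R V hV
    obtain ⟨ρ, hρ, hρV⟩ := Metric.nhds_basis_closedBall.mem_iff.1 hV
    have h1 : Filter.Tendsto t Filter.atTop (𝓝[>] 0) :=
      tendsto_nhdsWithin_iff.2 ⟨tendsto_one_div_add_atTop_nhds_zero_nat,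
        Filter.Eventually.of_forall htpos⟩
    have h2 : Filter.Tendsto (fun n => ‖D.dilLin (t n)‖ * R) Filter.atTop (𝓝 0) := by
      simpa using (D.tendsto_norm_dilLin.comp h1).mul_const R
    obtain ⟨n, hn⟩ := (h2.eventually_lt_const hρ).exists
    refine ⟨n, ?_⟩
    rintro _ ⟨X, hX, rfl⟩
    apply hρV
    rw [mem_closedBall_zero_iff] at hX ⊢
    exact ((D.dilLin (t n)).le_opNorm_of_le hX).trans hn.le
  have hmT : ∀ n, ∃ a : ℝ≥0∞, a ≠ 0 ∧ a ≠ ⊤ ∧ ∀ s, MeasurableSet s → m (T n '' s) = a * m s := by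
    intro n
    refine ⟨mulEquivHaarChar (D.dilEquiv (htpos n)), ?_, ENNReal.coe_ne_top, fun s _ => ?_⟩
    · exact ENNReal.coe_ne_zero.2 (mulEquivHaarChar_pos _).ne'
    · have h1 : expMap E G '' (T n '' s) = D.dilEquiv (htpos n) '' (expMap E G '' s) := by
        rw [Set.image_image, Set.image_image]
        exact Set.image_congr fun X _ => (D.dil_expMap (htpos n) X).symm
      rw [hm_apply, hm_apply, h1, ← mulEquivHaarChar_smul_preimage μ (D.dilEquiv (htpos n)),
        Set.preimage_image_eq _ (D.dilEquiv (htpos n)).injective]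
      rfl
  have hνT : ∀ n, ∃ a : ℝ≥0∞, a ≠ 0 ∧ a ≠ ⊤ ∧ ∀ s, MeasurableSet s → ν (T n '' s) = a * ν s := by
    intro n
    refine ⟨_, ?_, ENNReal.ofReal_ne_top, fun s _ =>
      Measure.addHaar_image_continuousLinearEquiv ν (D.dilLinEquiv (htpos n)) s⟩
    have h1 := (LinearEquiv.isUnit_det' (D.dilLinEquiv (htpos n)).toLinearEquiv).ne_zero
    simpa using h1
  -- By continuity and `J 0 = 1`, the density lies between `c⁻¹` and `c` near the origin.
  have hloc : ∀ c : ℝ≥0∞, 1 < c → c ≠ ⊤ → ∃ V ∈ 𝓝 (0 : E), ∀ s ⊆ V, MeasurableSet s →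
      m s ≤ c * ν s ∧ ν s ≤ c * m s := by
    intro c hc hct
    have hcJ : ContinuousAt J 0 := hJ.continuousAt hU
    have h1 : ∀ᶠ X in 𝓝 (0 : E), J X < c := hcJ.eventually_lt_const (by rwa [hJ0])
    have h2 : ∀ᶠ X in 𝓝 (0 : E), c⁻¹ < J X :=
      hcJ.eventually_const_lt (by rw [hJ0]; exact ENNReal.inv_lt_one.2 hc)
    refine ⟨U ∩ {X | J X < c ∧ c⁻¹ < J X}, Filter.inter_mem hU (h1.and h2), fun s hs hsm => ?_⟩
    rw [hm_apply, hJμ s (hs.trans Set.inter_subset_left) hsm]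
    constructor
    · calc ∫⁻ X in s, J X ∂ν ≤ ∫⁻ _ in s, c ∂ν := setLIntegral_mono' hsm fun X hX => (hs hX).2.1.le
        _ = c * ν s := setLIntegral_const _ _
    · calc ν s = c * (c⁻¹ * ν s) := by
            rw [← mul_assoc, ENNReal.mul_inv_cancel (one_pos.trans hc).ne' hct, one_mul]
        _ = c * ∫⁻ _ in s, c⁻¹ ∂ν := by rw [setLIntegral_const]
        _ ≤ c * ∫⁻ X in s, J X ∂ν := by
            gcongr c * ?_
            exact setLIntegral_mono' hsm fun X hX => (hs hX).2.2.le
  have hle : m ≤ ν := measure_le_of_contractions hTm hTball hmT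
    (fun n => (hνT n).imp fun _ h => h.2.2) hloc
  have hge : ν ≤ m := measure_le_of_contractions hTm hTball hνT
    (fun n => (hmT n).imp fun _ h => h.2.2)
    fun c hc hct => (hloc c hc hct).imp fun _ h => ⟨h.1, fun s hs hsm => (h.2 s hs hsm).symm⟩
  have hmν : m = ν := le_antisymm hle hge
  exact ⟨D.expHomeomorph.measurable, by rw [← hmν, hμm]⟩

/-- The exponential map of a homogeneous group, as a homeomorphism from its Lie algebra. -/
noncomputable def lieExpHomeomorph (D : HomogeneousStructure E G) :
    GroupLieAlgebra 𝓘(ℝ, E) G ≃ₜ G :=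
  D.expHomeomorph

theorem measurePreserving_lieExpHomeomorph (D : HomogeneousStructure E G) (μ : Measure G)
    [μ.IsHaarMeasure] (ν : Measure (GroupLieAlgebra 𝓘(ℝ, E) G)) [hν : ν.IsAddHaarMeasure]
    (h : ExpNormalized μ ν) : MeasurePreserving D.lieExpHomeomorph ν μ := by
  obtain ⟨U, hU, J, hJ, hJ0, hJμ⟩ := h
  -- The Lie algebra is definitionally `E`; giving `E` its Borel structure lets `ν` be read as a
  -- measure on the model space.
  let : MeasurableSpace E := borel E
  have : BorelSpace E := ⟨rfl⟩
  let ν' : Measure E := ν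
  have : ν'.IsAddHaarMeasure := hν
  exact D.measurePreserving_expHomeomorph μ ν' hU hJ hJ0 hJμ

end HomogeneousStructure

end HaarMeasure

end BrascampLieb
theorem theoremA {ι : Type*} [Fintype ι]
    -- the homogeneous group `G`
    {E : Type*} [NormedAddCommGroup E] [NormedSpace ℝ E] [FiniteDimensional ℝ E]
    {G : Type*} [TopologicalSpace G] [T2Space G] [ChartedSpace E G] [Group G]
    [LieGroup 𝓘(ℝ, E) ∞ G] [SimplyConnectedSpace G] [MeasurableSpace G] [BorelSpace G]
    (D : BrascampLieb.HomogeneousStructure E G)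
    -- the homogeneous groups `G_j`
    {Es : ι → Type*} [∀ j, NormedAddCommGroup (Es j)] [∀ j, NormedSpace ℝ (Es j)]
    [∀ j, FiniteDimensional ℝ (Es j)]
    {Gs : ι → Type*} [∀ j, TopologicalSpace (Gs j)] [∀ j, T2Space (Gs j)]
    [∀ j, ChartedSpace (Es j) (Gs j)] [∀ j, Group (Gs j)]
    [∀ j, LieGroup 𝓘(ℝ, Es j) ∞ (Gs j)] [∀ j, SimplyConnectedSpace (Gs j)]
    [∀ j, MeasurableSpace (Gs j)] [∀ j, BorelSpace (Gs j)]
    (Ds : ∀ j, BrascampLieb.HomogeneousStructure (Es j) (Gs j))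
    -- a canonical datum of homogeneous groups, with exponents in `[1, ∞]`
    (σ : ∀ j, G →* Gs j) (hσ : BrascampLieb.IsCanonical σ)
    (hdil : ∀ (j : ι) (t : ℝ), 0 < t → ∀ x : G, σ j (D.dil t x) = (Ds j).dil t (σ j x))
    (p : ι → ℝ≥0∞) (hp : ∀ j, 1 ≤ p j)
    -- the scaling condition `Q = ∑ j, Q_j / p_j`
    (hQ : D.homDim = ∑ j, (Ds j).homDim * ((p j)⁻¹).toReal)
    -- Haar measures on the groups and compatibly normalised Lebesgue measures on the Lie algebras
    (μ : Measure G) [μ.IsHaarMeasure]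
    (μs : ∀ j, Measure (Gs j)) [∀ j, (μs j).IsHaarMeasure]
    (ν : Measure (GroupLieAlgebra 𝓘(ℝ, E) G)) [ν.IsAddHaarMeasure]
    (νs : ∀ j, Measure (GroupLieAlgebra 𝓘(ℝ, Es j) (Gs j))) [∀ j, (νs j).IsAddHaarMeasure]
    (hν : BrascampLieb.ExpNormalized μ ν)
    (hνs : ∀ j, BrascampLieb.ExpNormalized (μs j) (νs j)) :
    (∀ j, MDifferentiableAt 𝓘(ℝ, E) 𝓘(ℝ, Es j) (σ j) 1) ∧
      BrascampLieb.blConst μ μs (fun j => σ j) p =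
        BrascampLieb.blConst ν νs (fun j => BrascampLieb.lieDiff (σ j)) p := by

  have hcont : ∀ j, Continuous (σ j) := fun j => (continuous_apply j).comp hσ.continuous
  refine ⟨fun j => D.mdifferentiableAt_of_continuous (Ds j) (hcont j), ?_⟩
  exact BrascampLieb.blConst_eq_of_conj D.lieExpHomeomorph.toMeasurableEquiv
    (D.measurePreserving_lieExpHomeomorph μ ν hν) (fun j => (Ds j).lieExpHomeomorph)
    (fun j => (Ds j).measurePreserving_lieExpHomeomorph (μs j) (νs j) (hνs j))
    fun j X => (D.expHomeomorph_lieDiff (Ds j) (hcont j) X).symm
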